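/- For a set $S\subseteq[N]=\{1,\dots,N\}$, $S\neq\emptyset$, let $|S\rangle=\frac1{\sqrt{|S|}}\sum_{i\in S}|i\rangle$, and let the membership oracle be the unitary $\mathcal O_S|i\rangle|b\rangle=(1-2bx_i)|i\rangle|b\rangle$ ($i\in[N]$, $b\in\{0,1\}$), where $x_i=1$ if $i\in S$ and $x_i=0$ otherwise. Fix an encoding of the basis states $|i\rangle|j\rangle$ ($i,j\in[N]$) as distinct $m$-qubit computational basis states, all different from $|0^m\rangle$; thus $|S\rangle|S\rangle$ is an $m$-qubit state orthogonal to $|0^m\rangle$. Let $V$ be the $m$-qubit unitary that reflects about the state $|\varphi\rangle=\frac1{\sqrt2}\bigl(|0^m\rangle-|S\rangle|S\rangle\bigr)$, i.e. $V=\mathbb 1-2|\varphi\rangle\langle\varphi|$: it swaps $|0^m\rangle$ with $|S\rangle|S\rangle$ and is the identity on the orthogonal complement of their span. **Theorem.** There is a universal constant $c>0$ such that the following holds for all integers $N,w,m$ with $w\ge 1$ and $2w\le N$, and every such encoding. Let $Q$ be a quantum algorithm (a fixed initial state, a sequence of $S$-independent unitaries on a memory of arbitrary finite dimension interleaved with oracle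 calls, and a final measurement) that makes $T$ queries to the membership oracle $\mathcal O_S$ and a total of $R$ uses of $V$, its inverse, and controlled-$V$. If $Q$ decides whether $|S|=w$ or $|S|=2w$ with success probability at least $2/3$ on every $S\subseteq[N]$ with $|S|\in\{w,2w\}$, then $$T\ \ge\ c\,\sqrt{\frac Nw}\qquad\text{or}\qquad R\ \ge\ c\,\min\left\{w^{1/3},\sqrt{\frac Nw}\right\}.$$ -/

import Mathlib

open scoped Kronecker Matrix

noncomputable section

namespace ApxCount

/-- Computational basis states of `m` qubits. -/
abbrev Bits (m : ℕ) : Type := Fin m → Bool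

/-- The basis label of `|0^m⟩`. -/
def zeroBits (m : ℕ) : Bits m := fun _ => false

/-- The state `|S⟩ = |S|^{-1/2} ∑_{i ∈ S} |i⟩`, as a vector of amplitudes. -/
def ketS {N : ℕ} (S : Finset (Fin N)) : Fin N → ℂ :=
  fun i => if i ∈ S then ((1 / Real.sqrt (S.card : ℝ) : ℝ) : ℂ) else 0

/-- How basis states `|i⟩|j⟩` with `i, j ∈ [N]` are written as `m`-qubit basis states, none of
them as `|0^m⟩` (so that `|0^m⟩` is orthogonal to `|S⟩|S⟩` for every `S`). -/
structure PairEncoding (N m : ℕ) where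
  enc : Fin N × Fin N → Bits m
  injective : Function.Injective enc
  ne_zero : ∀ p, enc p ≠ zeroBits m

/-- The `m`-qubit state `|S⟩|S⟩`. -/
def ketSS {N m : ℕ} (e : PairEncoding N m) (S : Finset (Fin N)) : Bits m → ℂ :=
  fun z => ∑ p : Fin N × Fin N, if e.enc p = z then ketS S p.1 * ketS S p.2 else 0

/-- The state `(|0^m⟩ - |S⟩|S⟩) / √2`. -/
def reflState {N m : ℕ} (e : PairEncoding N m) (S : Finset (Fin N)) : Bits m → ℂ :=
  fun z => ((1 / Real.sqrt 2 : ℝ) : ℂ) * ((if z = zeroBits m then 1 else 0) - ketSS e S z)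

/-- The unitary `V = 1 - 2|φ⟩⟨φ|`, the reflection about `|φ⟩ = (|0^m⟩ - |S⟩|S⟩) / √2`. -/
def unitaryV {N m : ℕ} (e : PairEncoding N m) (S : Finset (Fin N)) :
    Matrix (Bits m) (Bits m) ℂ :=
  1 - (2 : ℂ) • Matrix.vecMulVec (reflState e S) (star (reflState e S))

/-- Controlled-`V`: `|0⟩⟨0| ⊗ 1 + |1⟩⟨1| ⊗ V`. -/
def controlledV {N m : ℕ} (e : PairEncoding N m) (S : Finset (Fin N)) :
    Matrix (Bool × Bits m) (Bool × Bits m) ℂ :=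
  Matrix.single false false 1 ⊗ₖ (1 : Matrix (Bits m) (Bits m) ℂ) +
    Matrix.single true true 1 ⊗ₖ unitaryV e S

/-- The membership oracle `O_S |i⟩|b⟩ = (1 - 2 b x_i) |i⟩|b⟩`, where `x_i = 1` if `i ∈ S` and
`x_i = 0` otherwise. -/
def membershipOracle {N : ℕ} (S : Finset (Fin N)) : Matrix (Fin N × Bool) (Fin N × Bool) ℂ :=
  Matrix.diagonal fun q => 1 - 2 * (if q.2 = true then 1 else 0) * (if q.1 ∈ S then 1 else 0)

/-- Basis states of the whole memory: the query register `|i⟩|b⟩`, the control qubit and the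
`m`-qubit register to which (controlled-)`V` is applied, and a workspace with basis `W`. -/
abbrev Basis (N m : ℕ) (W : Type*) : Type _ := (Fin N × Bool) × ((Bool × Bits m) × W)

/-- One step of an algorithm: an arbitrary unitary on the whole memory that does not depend on
`S`, a membership query, or a use of `V`, of its inverse or of controlled-`V`. -/
inductive Step (N m : ℕ) (W : Type*) [Fintype W] [DecidableEq W] where
  | free (U : Matrix.unitaryGroup (Basis N m W) ℂ)
  | query
  | useV
  | useVInv
  | useControlledV

/-- A quantum algorithm: an initial unit vector, a list of steps (executed from first to last),
and a final measurement in the computational basis that accepts on the outcomes in `accept`. The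
initial state, the free unitaries and the accepting outcomes do not depend on `S`. -/
structure Algorithm (N m : ℕ) (W : Type*) [Fintype W] [DecidableEq W] where
  init : Basis N m W → ℂ
  init_unit : ∑ z, ‖init z‖ ^ 2 = 1
  steps : List (Step N m W)
  accept : Finset (Basis N m W)

section Run

variable {N m : ℕ} {W : Type*} [Fintype W] [DecidableEq W]

/-- The operator on the whole memory that a step performs when the input is `S`. -/
def Step.toMatrix (e : PairEncoding N m) (S : Finset (Fin N)) :
    Step N m W → Matrix (Basis N m W) (Basis N m W) ℂ
  | .free U => (U : Matrix (Basis N m W) (Basis N m W) ℂ)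
  | .query => membershipOracle S ⊗ₖ (1 : Matrix ((Bool × Bits m) × W) ((Bool × Bits m) × W) ℂ)
  | .useV => (1 : Matrix (Fin N × Bool) (Fin N × Bool) ℂ) ⊗ₖ
      (((1 : Matrix Bool Bool ℂ) ⊗ₖ unitaryV e S) ⊗ₖ (1 : Matrix W W ℂ))
  | .useVInv => (1 : Matrix (Fin N × Bool) (Fin N × Bool) ℂ) ⊗ₖ
      (((1 : Matrix Bool Bool ℂ) ⊗ₖ (unitaryV e S)⁻¹) ⊗ₖ (1 : Matrix W W ℂ))
  | .useControlledV => (1 : Matrix (Fin N × Bool) (Fin N × Bool) ℂ) ⊗ₖ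
      (controlledV e S ⊗ₖ (1 : Matrix W W ℂ))

/-- Number of membership queries in a step. -/
def Step.queryCost : Step N m W → ℕ
  | .query => 1
  | _ => 0

/-- Number of uses of `V`, its inverse or controlled-`V` in a step. -/
def Step.vCost : Step N m W → ℕ
  | .useV => 1
  | .useVInv => 1
  | .useControlledV => 1
  | _ => 0

/-- `T`: the total number of membership queries of the algorithm. -/
def Algorithm.numQueries (Q : Algorithm N m W) : ℕ := (Q.steps.map Step.queryCost).sum

/-- `R`: the total number of uses of `V`, its inverse and controlled-`V`. -/
def Algorithm.numUsesV (Q : Algorithm N m W) : ℕ := (Q.steps.map Step.vCost).sum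

/-- The state before the final measurement, on input `S`. -/
def Algorithm.finalState (Q : Algorithm N m W) (e : PairEncoding N m) (S : Finset (Fin N)) :
    Basis N m W → ℂ :=
  Q.steps.foldl (fun ψ s => s.toMatrix e S *ᵥ ψ) Q.init

/-- The probability that the algorithm accepts on input `S`. -/
def Algorithm.acceptProb (Q : Algorithm N m W) (e : PairEncoding N m) (S : Finset (Fin N)) : ℝ :=
  ∑ z ∈ Q.accept, ‖Q.finalState e S z‖ ^ 2

/-- The algorithm decides, with probability at least `2/3` of being correct on every input,
whether `|S| = w` (reject) or `|S| = 2w` (accept), promised that one of the two holds. -/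
def Algorithm.Decides (Q : Algorithm N m W) (e : PairEncoding N m) (w : ℕ) : Prop :=
  ∀ S : Finset (Fin N),
    (S.card = w → 1 - Q.acceptProb e S ≥ 2 / 3) ∧ (S.card = 2 * w → Q.acceptProb e S ≥ 2 / 3)

end Run

end ApxCount

end

namespace ApxCount

/-! The proof is the polynomial method for Laurent polynomials. With `x_i` the membership
indicators, the amplitudes of `|S⟩|S⟩` are `x_i x_j / |S|`, so `|S|^2 V` has entries of degree at
most 4 in the `x_i`. Hence `|S|^(4R)` times the acceptance probability has degree at most `2T + 8R`
(`Algorithm.card_pow_mul_acceptProb_mem_lowDeg`). Averaging over all `S` of size `k` gives `k^(-4R)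
P(k)` with `deg P ≤ 2T + 8R` (`Algorithm.exists_polynomial_averageAcceptProb`): a Laurent polynomial
`q` with exponents from `-B` to `A`, where `B = 4R` and `A = 2T + 4R`. Unitarity puts `q(k)` in `[0,
1]` for `1 ≤ k ≤ N`.

It remains to see that such a `q` cannot jump between `w` and `2w` when `100 w A^2 ≤ N` and `400 B^3
≤ w` (`not_laurent_approximation`). The certificate is dual: a polynomial of degree at most `A + B`
has vanishing divided difference on `A + B + 2` nodes (`sum_weight_eq_zero`). The nodes are `w`,
`2w`, the points `100 w (a+1)^2` for `a < A`, and the rounded points `w / (100 (b+1)^2)` for `b <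
B`. The weights at `w` and `2w` have opposite signs and size at least `c = 1 / (w * highProd w A)`;
the others are at most `c / (20 (l+1)^2)` (`abs_weight_high_le`, `abs_weight_low_le`), which is
summable with a small total. So the values at the other nodes cannot balance a jump.

The exponent `1/3` comes from rounding the low points to integers. Rounding shrinks their mutual
distances, but the unrounded products exceed `1/2` by a factor `exp(L^2 / (2B))` with `L = l + 1`
(`half_exp_le_prod_sq_sub_sq`), and this pays for the loss as soon as `400 B^3 ≤ w`. -/

/-- Functions of `S` that are polynomials of degree at most `d` in the membership indicators. -/
def lowDeg (N d : ℕ) : Submodule ℂ (Finset (Fin N) → ℂ) :=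
  Submodule.span ℂ {F | ∃ I : Finset (Fin N), I.card ≤ d ∧ F = fun S => if I ⊆ S then 1 else 0}

/-! ### Polynomials in the membership indicators, and the entries of `V`. -/

section LowDeg

variable {N : ℕ}

lemma lowDeg_mono {d d' : ℕ} (h : d ≤ d') : lowDeg N d ≤ lowDeg N d' := by
  refine Submodule.span_mono ?_
  rintro F ⟨I, hI, rfl⟩
  exact ⟨I, hI.trans h, rfl⟩

lemma indicator_mem_lowDeg (I : Finset (Fin N)) :
    (fun S : Finset (Fin N) => if I ⊆ S then (1 : ℂ) else 0) ∈ lowDeg N I.card :=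
  Submodule.subset_span ⟨I, le_rfl, rfl⟩

lemma const_mem_lowDeg (a : ℂ) (d : ℕ) : (fun _ : Finset (Fin N) => a) ∈ lowDeg N d := by
  have h := (lowDeg N 0).smul_mem a (indicator_mem_lowDeg (N := N) ∅)
  refine lowDeg_mono (Nat.zero_le d) ?_
  convert h using 1
  ext S
  simp

lemma mem_indicator_mem_lowDeg (i : Fin N) :
    (fun S : Finset (Fin N) => if i ∈ S then (1 : ℂ) else 0) ∈ lowDeg N 1 := by
  simpa using indicator_mem_lowDeg {i}

lemma mul_mem_lowDeg {d d' : ℕ} {F G : Finset (Fin N) → ℂ} (hF : F ∈ lowDeg N d)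
    (hG : G ∈ lowDeg N d') : (fun S => F S * G S) ∈ lowDeg N (d + d') := by
  change F * G ∈ _
  induction hF using Submodule.span_induction with
  | mem F hF =>
    obtain ⟨I, hI, rfl⟩ := hF
    induction hG using Submodule.span_induction with
    | mem G hG =>
      obtain ⟨J, hJ, rfl⟩ := hG
      refine lowDeg_mono ((Finset.card_union_le I J).trans (add_le_add hI hJ)) ?_
      convert indicator_mem_lowDeg (I ∪ J) using 1
      ext S
      simp only [Pi.mul_apply, Finset.union_subset_iff]
      split_ifs <;> simp_all
    | zero => rw [mul_zero]; exact Submodule.zero_mem _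
    | add x y _ _ hx hy => rw [mul_add]; exact Submodule.add_mem _ hx hy
    | smul a x _ hx => rw [mul_smul_comm]; exact Submodule.smul_mem _ a hx
  | zero => rw [zero_mul]; exact Submodule.zero_mem _
  | add x y _ _ hx hy => rw [add_mul]; exact Submodule.add_mem _ hx hy
  | smul a x _ hx => rw [smul_mul_assoc]; exact Submodule.smul_mem _ a hx

lemma star_mem_lowDeg {d : ℕ} {F : Finset (Fin N) → ℂ} (hF : F ∈ lowDeg N d) :
    (fun S => star (F S)) ∈ lowDeg N d := by
  change star F ∈ _
  induction hF using Submodule.span_induction with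
  | mem F hF =>
    obtain ⟨I, hI, rfl⟩ := hF
    refine lowDeg_mono hI ?_
    convert indicator_mem_lowDeg I using 1
    ext S
    simp only [Pi.star_apply]
    split_ifs <;> simp
  | zero => rw [star_zero]; exact Submodule.zero_mem _
  | add x y _ _ hx hy => rw [star_add]; exact Submodule.add_mem _ hx hy
  | smul a x _ hx => rw [star_smul]; exact Submodule.smul_mem _ _ hx

lemma sum_mem_lowDeg {ι : Type*} {d : ℕ} (s : Finset ι) {F : ι → Finset (Fin N) → ℂ}
    (hF : ∀ i ∈ s, F i ∈ lowDeg N d) : (fun S => ∑ i ∈ s, F i S) ∈ lowDeg N d := by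
  have h := Submodule.sum_mem (lowDeg N d) hF
  convert h using 1
  ext S
  simp

lemma sub_mem_lowDeg {d : ℕ} {F G : Finset (Fin N) → ℂ} (hF : F ∈ lowDeg N d)
    (hG : G ∈ lowDeg N d) : (fun S => F S - G S) ∈ lowDeg N d :=
  Submodule.sub_mem _ hF hG

lemma card_mem_lowDeg : (fun S : Finset (Fin N) => (S.card : ℂ)) ∈ lowDeg N 1 := by
  have h := sum_mem_lowDeg Finset.univ (fun i _ => mem_indicator_mem_lowDeg (N := N) i)
  convert h using 1
  ext S
  simp

/-- The two copies of `|S⟩` make the square roots cancel: the amplitude at `(i, j)` is `x_i x_j /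
|S|`, a single copy would leave `√|S|`. -/
lemma card_mul_ketSS {m : ℕ} (e : PairEncoding N m) (S : Finset (Fin N)) (z : Bits m) :
    (S.card : ℂ) * ketSS e S z = ∑ p : Fin N × Fin N,
      if e.enc p = z then (if p.1 ∈ S then 1 else 0) * (if p.2 ∈ S then 1 else 0) else 0 := by
  rw [ketSS, Finset.mul_sum]
  refine Finset.sum_congr rfl fun p _ => ?_
  split_ifs with h h1 h2 h2
  · have hpos : (0 : ℝ) < S.card := by exact_mod_cast Finset.card_pos.mpr ⟨_, h1⟩
    have : (S.card : ℝ) * (1 / √(S.card : ℝ) * (1 / √(S.card : ℝ))) = 1 := by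
      rw [div_mul_div_comm, Real.mul_self_sqrt hpos.le]
      field_simp
    simp only [ketS, h1, h2, if_true, mul_one]
    exact_mod_cast this
  · simp [ketS, h2]
  · simp [ketS, h1]
  · simp [ketS, h1]
  · simp

lemma card_mul_ketSS_mem_lowDeg {m : ℕ} (e : PairEncoding N m) (z : Bits m) :
    (fun S => (S.card : ℂ) * ketSS e S z) ∈ lowDeg N 2 := by
  simp_rw [card_mul_ketSS]
  refine sum_mem_lowDeg _ fun p _ => ?_
  by_cases h : e.enc p = z
  · simp only [h, if_true]
    have h := mul_mem_lowDeg (mem_indicator_mem_lowDeg p.1) (mem_indicator_mem_lowDeg p.2)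
    exact h
  · simp only [h, if_false]
    exact const_mem_lowDeg 0 2

lemma unitaryV_apply {m : ℕ} (e : PairEncoding N m) (S : Finset (Fin N)) (z z' : Bits m) :
    unitaryV e S z z' = (1 : Matrix (Bits m) (Bits m) ℂ) z z' -
      ((if z = zeroBits m then 1 else 0) - ketSS e S z) *
        star ((if z' = zeroBits m then 1 else 0) - ketSS e S z') := by
  have h2 : ((1 / √2 : ℝ) : ℂ) * ((1 / √2 : ℝ) : ℂ) = 1 / 2 := by
    rw [← Complex.ofReal_mul, div_mul_div_comm, Real.mul_self_sqrt (by norm_num)]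
    norm_num
  simp only [unitaryV, Matrix.sub_apply, Matrix.smul_apply, Matrix.vecMulVec_apply, Pi.star_apply,
    reflState, smul_eq_mul, star_mul', Complex.star_def, Complex.conj_ofReal]
  linear_combination (-2 * ((if z = zeroBits m then 1 else 0) - ketSS e S z) *
        (starRingEnd ℂ) ((if z' = zeroBits m then 1 else 0) - ketSS e S z')) * h2

/-- An entry of `V` is a constant minus a product of two amplitudes, each of which needs one factor
`|S|` to become a polynomial of degree 2. -/
lemma card_sq_mul_unitaryV_mem_lowDeg {m : ℕ} (e : PairEncoding N m) (z z' : Bits m) :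
    (fun S => (S.card : ℂ) ^ 2 * unitaryV e S z z') ∈ lowDeg N 4 := by
  have hg : ∀ z : Bits m, (fun S : Finset (Fin N) =>
      (S.card : ℂ) * ((if z = zeroBits m then 1 else 0) - ketSS e S z)) ∈ lowDeg N 2 := by
    intro z
    have h1 := mul_mem_lowDeg card_mem_lowDeg
      (const_mem_lowDeg (N := N) (if z = zeroBits m then 1 else 0) 1)
    have h := sub_mem_lowDeg h1 (card_mul_ketSS_mem_lowDeg e z)
    simpa only [mul_sub] using h
  have h1 := mul_mem_lowDeg (mul_mem_lowDeg card_mem_lowDeg card_mem_lowDeg)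
      (const_mem_lowDeg (N := N) ((1 : Matrix (Bits m) (Bits m) ℂ) z z') 2)
  have h2 := mul_mem_lowDeg (hg z) (star_mem_lowDeg (hg z'))
  have h := sub_mem_lowDeg h1 h2
  convert h using 1
  ext S
  rw [unitaryV_apply]
  simp only [star_mul', star_natCast]
  ring

lemma ketSS_enc {m : ℕ} (e : PairEncoding N m) (S : Finset (Fin N)) (p : Fin N × Fin N) :
    ketSS e S (e.enc p) = ketS S p.1 * ketS S p.2 := by
  simp [ketSS, e.injective.eq_iff]

lemma ketSS_zeroBits {m : ℕ} (e : PairEncoding N m) (S : Finset (Fin N)) :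
    ketSS e S (zeroBits m) = 0 := by
  simp [ketSS, e.ne_zero]

lemma sum_ketS_mul_star {S : Finset (Fin N)} (hS : S.Nonempty) :
    ∑ i, ketS S i * star (ketS S i) = 1 := by
  have hpos : (0 : ℝ) < S.card := by exact_mod_cast hS.card_pos
  have h : ∀ i, ketS S i * star (ketS S i) = if i ∈ S then ((1 / S.card : ℝ) : ℂ) else 0 := by
    intro i
    unfold ketS
    split_ifs
    · rw [Complex.star_def, Complex.conj_ofReal, ← Complex.ofReal_mul, div_mul_div_comm,
        Real.mul_self_sqrt hpos.le, one_mul]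
    · simp
  simp_rw [h]
  rw [Finset.sum_ite_mem, Finset.univ_inter, Finset.sum_const, nsmul_eq_mul]
  have : (S.card : ℝ) * (1 / S.card) = 1 := by field_simp
  exact_mod_cast this

lemma sum_ketSS_mul_star {m : ℕ} (e : PairEncoding N m) {S : Finset (Fin N)} (hS : S.Nonempty) :
    ∑ z, ketSS e S z * star (ketSS e S z) = 1 := by
  calc ∑ z, ketSS e S z * star (ketSS e S z)
      = ∑ z, ∑ p : Fin N × Fin N,
          if e.enc p = z then ketS S p.1 * ketS S p.2 * star (ketSS e S z) else 0 := by
        refine Finset.sum_congr rfl fun z _ => ?_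
        nth_rewrite 1 [ketSS]
        rw [Finset.sum_mul]
        exact Finset.sum_congr rfl fun p _ => by rw [ite_mul, zero_mul]
    _ = ∑ p : Fin N × Fin N,
          (ketS S p.1 * star (ketS S p.1)) * (ketS S p.2 * star (ketS S p.2)) := by
        rw [Finset.sum_comm]
        refine Finset.sum_congr rfl fun p _ => ?_
        rw [Finset.sum_ite_eq, if_pos (Finset.mem_univ _), ketSS_enc, star_mul']
        ring
    _ = 1 := by
        rw [Fintype.sum_prod_type]
        dsimp only
        rw [← Finset.sum_mul_sum, sum_ketS_mul_star hS, one_mul]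

lemma star_reflState_dotProduct {m : ℕ} (e : PairEncoding N m) {S : Finset (Fin N)}
    (hS : S.Nonempty) : star (reflState e S) ⬝ᵥ reflState e S = 1 := by
  have h2 : ((1 / √2 : ℝ) : ℂ) * ((1 / √2 : ℝ) : ℂ) = 1 / 2 := by
    rw [← Complex.ofReal_mul, div_mul_div_comm, Real.mul_self_sqrt (by norm_num)]
    norm_num
  have h : ∀ z, star (reflState e S) z * reflState e S z =
      1 / 2 * ((if z = zeroBits m then 1 else 0) + ketSS e S z * star (ketSS e S z)) := by
    intro z
    rw [← h2]
    simp only [Pi.star_apply, reflState, star_mul', Complex.star_def, Complex.conj_ofReal,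
      map_sub]
    by_cases hz : z = zeroBits m
    · subst hz
      simp [ketSS_zeroBits]
    · simp only [hz, if_false, map_zero]
      ring
  rw [dotProduct, Finset.sum_congr rfl fun z _ => h z, ← Finset.mul_sum, Finset.sum_add_distrib,
    sum_ketSS_mul_star e hS, Finset.sum_ite_eq', if_pos (Finset.mem_univ _)]
  norm_num

lemma unitaryV_mul_self {m : ℕ} (e : PairEncoding N m) {S : Finset (Fin N)} (hS : S.Nonempty) :
    unitaryV e S * unitaryV e S = 1 := by
  have h : Matrix.vecMulVec (reflState e S) (star (reflState e S)) *
      Matrix.vecMulVec (reflState e S) (star (reflState e S)) =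
      Matrix.vecMulVec (reflState e S) (star (reflState e S)) := by
    rw [Matrix.vecMulVec_mul_vecMulVec, star_reflState_dotProduct e hS, one_smul]
  rw [unitaryV, sub_mul, mul_sub, mul_sub, smul_mul_smul_comm, h, one_mul, mul_one, one_mul]
  module

lemma unitaryV_conjTranspose {m : ℕ} (e : PairEncoding N m) (S : Finset (Fin N)) :
    (unitaryV e S)ᴴ = unitaryV e S := by
  simp [unitaryV, Matrix.conjTranspose_sub, Matrix.conjTranspose_smul,
    Matrix.conjTranspose_vecMulVec]

lemma unitaryV_inv {m : ℕ} (e : PairEncoding N m) {S : Finset (Fin N)} (hS : S.Nonempty) :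
    (unitaryV e S)⁻¹ = unitaryV e S :=
  Matrix.inv_eq_left_inv (unitaryV_mul_self e hS)

lemma card_sq_mul_unitaryV_inv_mem_lowDeg {m : ℕ} (e : PairEncoding N m) (z z' : Bits m) :
    (fun S => (S.card : ℂ) ^ 2 * (unitaryV e S)⁻¹ z z') ∈ lowDeg N 4 := by
  convert card_sq_mul_unitaryV_mem_lowDeg e z z' using 2 with S
  rcases S.eq_empty_or_nonempty with rfl | hS
  -- For `S = ∅` the matrix need not be its own inverse, but the factor `|S|^2` is zero.
  · simp
  · rw [unitaryV_inv e hS]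

lemma mul_const_mem_lowDeg {d : ℕ} {F : Finset (Fin N) → ℂ} (hF : F ∈ lowDeg N d) (a : ℂ) :
    (fun S => F S * a) ∈ lowDeg N d := by
  have h := mul_mem_lowDeg hF (const_mem_lowDeg a 0)
  exact h

lemma const_mul_mem_lowDeg {d : ℕ} {F : Finset (Fin N) → ℂ} (hF : F ∈ lowDeg N d) (a : ℂ) :
    (fun S => a * F S) ∈ lowDeg N d :=
  Submodule.smul_mem _ a hF

end LowDeg

/-! ### Acceptance probability as a polynomial, after clearing powers of `|S|`. -/

section Run

variable {N m : ℕ} {W : Type*} [Fintype W] [DecidableEq W]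

lemma Step.card_pow_mul_toMatrix_mem_lowDeg (e : PairEncoding N m) (s : Step N m W)
    (z z' : Basis N m W) :
    (fun S => (S.card : ℂ) ^ (2 * s.vCost) * s.toMatrix e S z z') ∈
      lowDeg N (s.queryCost + 4 * s.vCost) := by
  cases s with
  | free U => simpa [Step.toMatrix, Step.vCost, Step.queryCost] using const_mem_lowDeg _ 0
  | query =>
    simp only [Step.toMatrix, Step.vCost, Step.queryCost, Matrix.kroneckerMap_apply,
      membershipOracle, Matrix.diagonal_apply, mul_zero, pow_zero, one_mul, add_zero]
    refine mul_const_mem_lowDeg ?_ _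
    split_ifs with h1 h2
    · exact sub_mem_lowDeg (const_mem_lowDeg 1 1)
        (const_mul_mem_lowDeg (mem_indicator_mem_lowDeg _) _)
    · simpa using const_mem_lowDeg 1 1
    · exact const_mem_lowDeg 0 1
  | useV =>
    have h := mul_const_mem_lowDeg (card_sq_mul_unitaryV_mem_lowDeg e z.2.1.2 z'.2.1.2)
      ((1 : Matrix (Fin N × Bool) (Fin N × Bool) ℂ) z.1 z'.1 *
        (1 : Matrix Bool Bool ℂ) z.2.1.1 z'.2.1.1 * (1 : Matrix W W ℂ) z.2.2 z'.2.2)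
    simp only [Step.toMatrix, Step.vCost, Step.queryCost, Matrix.kroneckerMap_apply, zero_add,
      mul_one]
    convert h using 2
    ring
  | useVInv =>
    have h := mul_const_mem_lowDeg (card_sq_mul_unitaryV_inv_mem_lowDeg e z.2.1.2 z'.2.1.2)
      ((1 : Matrix (Fin N × Bool) (Fin N × Bool) ℂ) z.1 z'.1 *
        (1 : Matrix Bool Bool ℂ) z.2.1.1 z'.2.1.1 * (1 : Matrix W W ℂ) z.2.2 z'.2.2)
    simp only [Step.toMatrix, Step.vCost, Step.queryCost, Matrix.kroneckerMap_apply, zero_add,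
      mul_one]
    convert h using 2
    ring
  | useControlledV =>
    -- The idle branch of the control also picks up `|S|^2`, which has degree 2 and so stays within
    -- 4.
    have hcc := mul_mem_lowDeg (card_mem_lowDeg (N := N)) card_mem_lowDeg
    have hc := mul_const_mem_lowDeg (lowDeg_mono (by norm_num : 1 + 1 ≤ 4) hcc)
      ((1 : Matrix (Fin N × Bool) (Fin N × Bool) ℂ) z.1 z'.1 *
        (Matrix.single false false 1 : Matrix Bool Bool ℂ) z.2.1.1 z'.2.1.1 *
        (1 : Matrix (Bits m) (Bits m) ℂ) z.2.1.2 z'.2.1.2 * (1 : Matrix W W ℂ) z.2.2 z'.2.2)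
    have h := mul_const_mem_lowDeg (card_sq_mul_unitaryV_mem_lowDeg e z.2.1.2 z'.2.1.2)
      ((1 : Matrix (Fin N × Bool) (Fin N × Bool) ℂ) z.1 z'.1 *
        (Matrix.single true true 1 : Matrix Bool Bool ℂ) z.2.1.1 z'.2.1.1 *
        (1 : Matrix W W ℂ) z.2.2 z'.2.2)
    simp only [Step.toMatrix, Step.vCost, Step.queryCost, Matrix.kroneckerMap_apply, zero_add,
      mul_one, controlledV, Matrix.add_apply]
    convert Submodule.add_mem _ hc h using 1
    ext S
    simp only [Pi.add_apply]
    ring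

lemma card_pow_mul_foldl_mem_lowDeg (e : PairEncoding N m) (l : List (Step N m W)) :
    ∀ (d r : ℕ) (ψ : Finset (Fin N) → Basis N m W → ℂ),
      (∀ z, (fun S => (S.card : ℂ) ^ r * ψ S z) ∈ lowDeg N d) → ∀ z,
      (fun S => (S.card : ℂ) ^ (r + 2 * (l.map Step.vCost).sum) *
        l.foldl (fun ψ s => s.toMatrix e S *ᵥ ψ) (ψ S) z) ∈
        lowDeg N (d + (l.map Step.queryCost).sum + 4 * (l.map Step.vCost).sum) := by
  induction l with
  | nil => intro d r ψ h z; simpa using h z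
  | cons s l ih =>
    intro d r ψ h z
    have := ih (d + (s.queryCost + 4 * s.vCost)) (r + 2 * s.vCost)
      (fun S => s.toMatrix e S *ᵥ ψ S) ?_ z
    · simp only [List.map_cons, List.sum_cons, List.foldl_cons]
      convert this using 2
      · ring
      · ring
    · intro z
      have hs := sum_mem_lowDeg Finset.univ fun z' _ =>
        mul_mem_lowDeg (h z') (s.card_pow_mul_toMatrix_mem_lowDeg e z z')
      convert hs using 1
      ext S
      rw [Matrix.mulVec, dotProduct, Finset.mul_sum]
      refine Finset.sum_congr rfl fun z' _ => ?_
      ring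

/-- Up to a power of `|S|`, the acceptance probability is a polynomial in the membership
indicators. -/
lemma Algorithm.card_pow_mul_acceptProb_mem_lowDeg (Q : Algorithm N m W) (e : PairEncoding N m) :
    (fun S => (S.card : ℂ) ^ (4 * Q.numUsesV) * (Q.acceptProb e S : ℂ)) ∈
      lowDeg N (2 * Q.numQueries + 8 * Q.numUsesV) := by
  have hψ : ∀ z, (fun S => (S.card : ℂ) ^ (2 * Q.numUsesV) * Q.finalState e S z) ∈
      lowDeg N (Q.numQueries + 4 * Q.numUsesV) := by
    intro z
    have := card_pow_mul_foldl_mem_lowDeg e Q.steps 0 0 (fun _ => Q.init)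
      (fun z => by simpa using const_mem_lowDeg (Q.init z) 0) z
    simpa [Algorithm.finalState, Algorithm.numUsesV, Algorithm.numQueries] using this
  have h := sum_mem_lowDeg Q.accept fun z _ => mul_mem_lowDeg (hψ z) (star_mem_lowDeg (hψ z))
  rw [show 2 * Q.numQueries + 8 * Q.numUsesV =
    Q.numQueries + 4 * Q.numUsesV + (Q.numQueries + 4 * Q.numUsesV) by ring]
  convert h using 1
  ext S
  rw [Algorithm.acceptProb, Complex.ofReal_sum, Finset.mul_sum]
  refine Finset.sum_congr rfl fun z _ => ?_
  rw [Complex.ofReal_pow, ← Complex.mul_conj', star_mul', star_pow, star_natCast,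
    Complex.star_def]
  ring

end Run

/-! ### Unitarity, and acceptance probabilities in `[0, 1]`. -/

lemma unitaryV_mem_unitary {N m : ℕ} (e : PairEncoding N m) {S : Finset (Fin N)}
    (hS : S.Nonempty) : unitaryV e S ∈ unitary (Matrix (Bits m) (Bits m) ℂ) := by
  rw [Unitary.mem_iff, Matrix.star_eq_conjTranspose, unitaryV_conjTranspose]
  exact ⟨unitaryV_mul_self e hS, unitaryV_mul_self e hS⟩

lemma controlledV_mem_unitary {N m : ℕ} (e : PairEncoding N m) {S : Finset (Fin N)}
    (hS : S.Nonempty) :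
    controlledV e S ∈ unitary (Matrix (Bool × Bits m) (Bool × Bits m) ℂ) := by
  have hstar : star (controlledV e S) = controlledV e S := by
    rw [Matrix.star_eq_conjTranspose, controlledV, Matrix.conjTranspose_add,
      Matrix.conjTranspose_kronecker, Matrix.conjTranspose_kronecker, unitaryV_conjTranspose]
    simp
  have hsum : (Matrix.single false false 1 : Matrix Bool Bool ℂ) + Matrix.single true true 1 =
      1 := by
    ext i j
    cases i <;> cases j <;> simp
  have hsq : controlledV e S * controlledV e S = 1 := by
    rw [controlledV, add_mul, mul_add, mul_add, ← Matrix.mul_kronecker_mul,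
      ← Matrix.mul_kronecker_mul, ← Matrix.mul_kronecker_mul, ← Matrix.mul_kronecker_mul,
      unitaryV_mul_self e hS]
    simp [← Matrix.add_kronecker, hsum]
  rw [Unitary.mem_iff, hstar]
  exact ⟨hsq, hsq⟩

lemma membershipOracle_mem_unitary {N : ℕ} (S : Finset (Fin N)) :
    membershipOracle S ∈ unitary (Matrix (Fin N × Bool) (Fin N × Bool) ℂ) := by
  have hstar : star (membershipOracle S) = membershipOracle S := by
    rw [Matrix.star_eq_conjTranspose, membershipOracle, Matrix.diagonal_conjTranspose]
    congr 1
    ext q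
    simp only [Pi.star_apply]
    split_ifs <;> simp
  have hsq : membershipOracle S * membershipOracle S = 1 := by
    rw [membershipOracle, Matrix.diagonal_mul_diagonal, ← Matrix.diagonal_one]
    congr 1
    ext q
    split_ifs <;> norm_num
  rw [Unitary.mem_iff, hstar]
  exact ⟨hsq, hsq⟩

section Run

variable {N m : ℕ} {W : Type*} [Fintype W] [DecidableEq W]

lemma Step.toMatrix_mem_unitary (e : PairEncoding N m) {S : Finset (Fin N)} (hS : S.Nonempty)
    (s : Step N m W) : s.toMatrix e S ∈ unitary (Matrix (Basis N m W) (Basis N m W) ℂ) := by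
  cases s with
  | free U => exact U.2
  | query =>
    exact Matrix.kronecker_mem_unitary (membershipOracle_mem_unitary S) (one_mem _)
  | useV =>
    exact Matrix.kronecker_mem_unitary (one_mem _) (Matrix.kronecker_mem_unitary
      (Matrix.kronecker_mem_unitary (one_mem _) (unitaryV_mem_unitary e hS)) (one_mem _))
  | useVInv =>
    rw [Step.toMatrix, unitaryV_inv e hS]
    exact Matrix.kronecker_mem_unitary (one_mem _) (Matrix.kronecker_mem_unitary
      (Matrix.kronecker_mem_unitary (one_mem _) (unitaryV_mem_unitary e hS)) (one_mem _))
  | useControlledV =>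
    exact Matrix.kronecker_mem_unitary (one_mem _) (Matrix.kronecker_mem_unitary
      (controlledV_mem_unitary e hS) (one_mem _))

lemma sum_norm_sq_mulVec_of_mem_unitary {ι : Type*} [Fintype ι] [DecidableEq ι]
    {M : Matrix ι ι ℂ} (hM : M ∈ unitary (Matrix ι ι ℂ)) (ψ : ι → ℂ) :
    ∑ z, ‖(M *ᵥ ψ) z‖ ^ 2 = ∑ z, ‖ψ z‖ ^ 2 := by
  have key : ∀ φ : ι → ℂ, ((∑ z, ‖φ z‖ ^ 2 : ℝ) : ℂ) = star φ ⬝ᵥ φ := by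
    intro φ
    rw [Complex.ofReal_sum, dotProduct]
    refine Finset.sum_congr rfl fun z _ => ?_
    rw [Complex.ofReal_pow, ← Complex.conj_mul', Pi.star_apply, Complex.star_def]
  have h : ((∑ z, ‖(M *ᵥ ψ) z‖ ^ 2 : ℝ) : ℂ) = ((∑ z, ‖ψ z‖ ^ 2 : ℝ) : ℂ) := by
    rw [key, key, Matrix.star_mulVec, Matrix.dotProduct_mulVec, Matrix.vecMul_vecMul,
      ← Matrix.star_eq_conjTranspose, Unitary.star_mul_self_of_mem hM, Matrix.vecMul_one]
  exact_mod_cast h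

lemma Algorithm.sum_norm_sq_finalState (Q : Algorithm N m W) (e : PairEncoding N m)
    {S : Finset (Fin N)} (hS : S.Nonempty) : ∑ z, ‖Q.finalState e S z‖ ^ 2 = 1 := by
  have h : ∀ (l : List (Step N m W)) (ψ : Basis N m W → ℂ),
      ∑ z, ‖l.foldl (fun ψ s => s.toMatrix e S *ᵥ ψ) ψ z‖ ^ 2 = ∑ z, ‖ψ z‖ ^ 2 := by
    intro l
    induction l with
    | nil => intro ψ; rfl
    | cons s l ih =>
      intro ψ
      rw [List.foldl_cons, ih, sum_norm_sq_mulVec_of_mem_unitary (s.toMatrix_mem_unitary e hS)]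
  rw [Algorithm.finalState, h, Q.init_unit]

lemma Algorithm.acceptProb_nonneg (Q : Algorithm N m W) (e : PairEncoding N m)
    (S : Finset (Fin N)) : 0 ≤ Q.acceptProb e S :=
  Finset.sum_nonneg fun _ _ => by positivity

lemma Algorithm.acceptProb_le_one (Q : Algorithm N m W) (e : PairEncoding N m)
    {S : Finset (Fin N)} (hS : S.Nonempty) : Q.acceptProb e S ≤ 1 := by
  rw [← Q.sum_norm_sq_finalState e hS]
  exact Finset.sum_le_sum_of_subset_of_nonneg (Finset.subset_univ _) fun _ _ _ => by positivity

end Run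

/-! ### Symmetrization over the sets of a given size. -/

section Average

variable {N : ℕ}

/-- Divided by `N.choose k`, this says that a random `k`-set contains `I` with a probability that is
a falling factorial in `k` of degree `|I|`, up to a constant. This is why averaging preserves the
degree. -/
lemma card_powersetCard_filter_superset (I : Finset (Fin N)) (k : ℕ) :
    ((Finset.univ.powersetCard k).filter (I ⊆ ·)).card * N.descFactorial I.card =
      N.choose k * k.descFactorial I.card := by
  rcases le_or_gt I.card k with hk | hk
  · have h1 : ((Finset.univ.powersetCard k).filter (I ⊆ ·)).card =
        (N - I.card).choose (k - I.card) := by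
      have hc : Iᶜ.card = N - I.card := by rw [Finset.card_compl, Fintype.card_fin]
      rw [← hc, ← Finset.card_powersetCard]
      refine Finset.card_bij' (fun S _ => S \ I) (fun S _ => S ∪ I) ?_ ?_ ?_ ?_
      · intro S hS
        simp only [Finset.mem_filter, Finset.mem_powersetCard] at hS ⊢
        refine ⟨fun x hx => ?_, ?_⟩
        · exact Finset.mem_compl.mpr (Finset.mem_sdiff.mp hx).2
        · rw [Finset.card_sdiff_of_subset hS.2, hS.1.2]
      · intro S hS
        simp only [Finset.mem_filter, Finset.mem_powersetCard] at hS ⊢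
        refine ⟨⟨Finset.subset_univ _, ?_⟩, Finset.subset_union_right⟩
        rw [Finset.card_union_of_disjoint, hS.2]
        · omega
        · rw [Finset.disjoint_left]
          intro x hx
          simpa using hS.1 hx
      · intro S hS
        simp only [Finset.mem_filter] at hS
        exact Finset.sdiff_union_of_subset hS.2
      · intro S hS
        simp only [Finset.mem_powersetCard] at hS
        refine Finset.union_sdiff_cancel_right ?_
        rw [Finset.disjoint_left]
        intro x hx
        simpa using hS.1 hx
    rw [h1, Nat.descFactorial_eq_factorial_mul_choose, Nat.descFactorial_eq_factorial_mul_choose]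
    have h := Nat.choose_mul (n := N) hk
    calc _ = I.card.factorial * (N.choose I.card * (N - I.card).choose (k - I.card)) := by ring
      _ = _ := by rw [← h]; ring
  · rw [Nat.descFactorial_eq_zero_iff_lt.mpr hk, Finset.card_eq_zero.mpr, zero_mul, mul_zero]
    rw [Finset.filter_eq_empty_iff]
    intro S hS hIS
    rw [Finset.mem_powersetCard] at hS
    have := Finset.card_le_card hIS
    omega

/-- Symmetrization: the average over all `S` with `|S| = k` of a polynomial of degree `d` in the
membership indicators is a polynomial of degree `d` in `k`. -/
lemma exists_polynomial_sum_powersetCard {d : ℕ} {F : Finset (Fin N) → ℂ} (hF : F ∈ lowDeg N d) :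
    ∃ P : Polynomial ℂ, P.natDegree ≤ d ∧ ∀ k : ℕ,
      ∑ S ∈ Finset.univ.powersetCard k, F S = N.choose k * P.eval (k : ℂ) := by
  induction hF using Submodule.span_induction with
  | mem F hF =>
    obtain ⟨I, hI, rfl⟩ := hF
    refine ⟨Polynomial.C ((N.descFactorial I.card : ℂ)⁻¹) * descPochhammer ℂ I.card, ?_, ?_⟩
    · refine (Polynomial.natDegree_C_mul_le _ _).trans ?_
      rwa [descPochhammer_natDegree]
    · intro k
      have hN : (N.descFactorial I.card : ℂ) ≠ 0 := by
        have : I.card ≤ N := by simpa using Finset.card_le_univ I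
        exact_mod_cast (Nat.descFactorial_pos.mpr this).ne'
      have h := card_powersetCard_filter_superset I k
      rw [Finset.sum_boole, Polynomial.eval_mul, Polynomial.eval_C,
        descPochhammer_eval_eq_descFactorial]
      field_simp
      exact_mod_cast h
  | zero => exact ⟨0, by simp, by simp⟩
  | add F G _ _ hF hG =>
    obtain ⟨P, hP, hP'⟩ := hF
    obtain ⟨R, hR, hR'⟩ := hG
    refine ⟨P + R, (Polynomial.natDegree_add_le _ _).trans (max_le hP hR), fun k => ?_⟩
    simp only [Pi.add_apply, Finset.sum_add_distrib, hP', hR', Polynomial.eval_add]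
    ring
  | smul a F _ hF =>
    obtain ⟨P, hP, hP'⟩ := hF
    refine ⟨Polynomial.C a * P, (Polynomial.natDegree_C_mul_le _ _).trans hP, fun k => ?_⟩
    simp only [Pi.smul_apply, smul_eq_mul, ← Finset.mul_sum, hP', Polynomial.eval_mul,
      Polynomial.eval_C]
    ring

end Average

/-! ### Product estimates, and the exact products over squares. -/

lemma prod_range_ite_mul {n l : ℕ} (hl : l < n) (f : ℕ → ℝ) :
    (∏ i ∈ Finset.range n, if i = l then 1 else f i) * f l = ∏ i ∈ Finset.range n, f i := by
  rw [← Finset.prod_erase_mul _ f (Finset.mem_range.mpr hl),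
    ← Finset.prod_erase_mul _ (fun i => if i = l then 1 else f i) (Finset.mem_range.mpr hl)]
  simp only [if_true, mul_one]
  congr 1
  refine Finset.prod_congr rfl fun i hi => if_neg (Finset.ne_of_mem_erase hi)

lemma one_sub_sum_le_prod (n : ℕ) (x : ℕ → ℝ) (h0 : ∀ i, 0 ≤ x i) (h1 : ∀ i, x i ≤ 1) :
    1 - ∑ i ∈ Finset.range n, x i ≤ ∏ i ∈ Finset.range n, (1 - x i) := by
  induction n with
  | zero => simp
  | succ n ih =>
    have hp : ∏ i ∈ Finset.range n, (1 - x i) ≤ 1 :=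
      Finset.prod_le_one (fun i _ => by linarith [h1 i]) fun i _ => by linarith [h0 i]
    rw [Finset.sum_range_succ, Finset.prod_range_succ]
    nlinarith [mul_nonneg (h0 n) (sub_nonneg.mpr hp)]

lemma sum_one_div_sq_le (n : ℕ) :
    ∑ i ∈ Finset.range n, 1 / ((i : ℝ) + 1) ^ 2 ≤ 2 := by
  -- Telescoping bound; at `n = 0` it relies on `1 / 0 = 0`.
  have h : ∑ i ∈ Finset.range n, 1 / ((i : ℝ) + 1) ^ 2 ≤ 2 - 1 / (n : ℝ) := by
    induction n with
    | zero => simp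
    | succ n ih =>
      rw [Finset.sum_range_succ]
      rcases Nat.eq_zero_or_pos n with rfl | hn
      · norm_num
      · have hn' : (0 : ℝ) < n := by exact_mod_cast hn
        have : 1 / ((n : ℝ) + 1) ^ 2 ≤ 1 / (n : ℝ) - 1 / ((n : ℝ) + 1) := by
          rw [div_sub_div _ _ hn'.ne' (by positivity), div_le_div_iff₀ (by positivity)
            (by positivity)]
          nlinarith
        push_cast
        linarith
  have : 0 ≤ 1 / (n : ℝ) := by positivity
  linarith

lemma half_le_prod_one_sub (n : ℕ) (x : ℕ → ℝ) (h0 : ∀ i, 0 ≤ x i)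
    (h1 : ∀ i, x i ≤ 1 / (100 * ((i : ℝ) + 1) ^ 2)) :
    1 / 2 ≤ ∏ i ∈ Finset.range n, (1 - x i) := by
  have hx : ∀ i, x i ≤ 1 := fun i => (h1 i).trans <| by
    rw [div_le_one (by positivity)]
    have : (1 : ℝ) ≤ (i : ℝ) + 1 := by linarith [(Nat.cast_nonneg i : (0 : ℝ) ≤ i)]
    nlinarith
  have hs : ∑ i ∈ Finset.range n, x i ≤ 1 / 100 * ∑ i ∈ Finset.range n, 1 / ((i : ℝ) + 1) ^ 2 := by
    rw [Finset.mul_sum]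
    refine Finset.sum_le_sum fun i _ => (h1 i).trans_eq ?_
    rw [div_mul_div_comm, one_mul]
  linarith [one_sub_sum_le_prod n x h0 hx, sum_one_div_sq_le n]

lemma prod_sq_sub_sq_eq_initial (l m : ℕ) (hm : m ≤ l) :
    (∏ i ∈ Finset.range m, |((l : ℝ) + 1) ^ 2 - ((i : ℝ) + 1) ^ 2| / ((i : ℝ) + 1) ^ 2) *
      ((l - m).factorial * (l + 1).factorial * (m.factorial : ℝ) ^ 2) =
      l.factorial * (l + 1 + m).factorial := by
  induction m with
  | zero => simp
  | succ m ih =>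
    specialize ih (by omega)
    obtain ⟨k, rfl⟩ : ∃ k, l = m + 1 + k := ⟨l - (m + 1), by omega⟩
    have e1 : m + 1 + k - m = k + 1 := by omega
    have e2 : m + 1 + k - (m + 1) = k := by omega
    have e3 : m + 1 + k + 1 + (m + 1) = (m + 1 + k + 1 + m) + 1 := by ring
    rw [e1, Nat.factorial_succ k] at ih
    rw [Finset.prod_range_succ, e2, e3, Nat.factorial_succ (m + 1 + k + 1 + m),
      Nat.factorial_succ m]
    have hpos : (0 : ℝ) ≤ (((m + 1 + k : ℕ) : ℝ) + 1) ^ 2 - ((m : ℝ) + 1) ^ 2 := by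
      push_cast
      nlinarith [(Nat.cast_nonneg m : (0 : ℝ) ≤ m), (Nat.cast_nonneg k : (0 : ℝ) ≤ k)]
    rw [abs_of_nonneg hpos]
    push_cast at ih ⊢
    rw [show ((m : ℝ) + 1 + k + 1 + m + 1) * ((m + 1 + k + 1 + m).factorial : ℝ) =
      (m + 1 + k + 1 + m + 1) * (m + 1 + k + 1 + m).factorial from rfl,
      mul_left_comm ((m + 1 + k).factorial : ℝ), ← ih]
    field_simp
    ring

/-- Put `L = l + 1`, `n = L + k` and `j = i + 1`. Factoring `L^2 - j^2 = (L - j)(L + j)` turns the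
product over `j ≠ L` into `(n - L)! (n + L)! / (2 n!^2)`; the 2 comes from the missing factor `L +
L`. -/
lemma prod_sq_sub_sq_eq (l k : ℕ) :
    (∏ i ∈ Finset.range (l + 1 + k), if i = l then (1 : ℝ) else
      |((l : ℝ) + 1) ^ 2 - ((i : ℝ) + 1) ^ 2| / ((i : ℝ) + 1) ^ 2) *
      (2 * ((l + 1 + k).factorial : ℝ) ^ 2) =
      k.factorial * (l + 1 + k + (l + 1)).factorial := by
  induction k with
  | zero =>
    have h := prod_sq_sub_sq_eq_initial l l le_rfl
    rw [add_zero, Finset.prod_range_succ, if_pos rfl, mul_one,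
      Finset.prod_congr rfl fun i hi => if_neg (Finset.mem_range.mp hi).ne]
    rw [Nat.sub_self, Nat.factorial_zero, Nat.factorial_succ l] at h
    rw [Nat.factorial_succ l, show l + 1 + (l + 1) = (l + 1 + l) + 1 by ring,
      Nat.factorial_succ (l + 1 + l), Nat.factorial_zero]
    have hl : (l.factorial : ℝ) ≠ 0 := by positivity
    push_cast at h ⊢
    have h' : (∏ i ∈ Finset.range l, |((l : ℝ) + 1) ^ 2 - ((i : ℝ) + 1) ^ 2| / ((i : ℝ) + 1) ^ 2) *
        ((l + 1) * (l.factorial : ℝ) ^ 2) = (l + 1 + l).factorial := by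
      apply mul_left_cancel₀ hl
      linear_combination h
    linear_combination 2 * (l + 1) * h'
  | succ k ih =>
    have hne : l + 1 + k ≠ l := by omega
    rw [← add_assoc (l + 1) k 1, Finset.prod_range_succ, if_neg hne, Nat.factorial_succ (l + 1 + k),
      Nat.factorial_succ k, show l + 1 + k + 1 + (l + 1) = (l + 1 + k + (l + 1)) + 1 by ring,
      Nat.factorial_succ (l + 1 + k + (l + 1))]
    have hneg : ((l : ℝ) + 1) ^ 2 - (((l + 1 + k : ℕ) : ℝ) + 1) ^ 2 ≤ 0 := by
      push_cast
      nlinarith [(Nat.cast_nonneg l : (0 : ℝ) ≤ l), (Nat.cast_nonneg k : (0 : ℝ) ≤ k)]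
    rw [abs_of_nonpos hneg]
    push_cast at ih ⊢
    rw [show ((k : ℝ) + 1) * k.factorial * ((l + 1 + k + (l + 1) + 1) *
      (l + 1 + k + (l + 1)).factorial) = (k + 1) * (l + 1 + k + (l + 1) + 1) *
      (k.factorial * (l + 1 + k + (l + 1)).factorial) by ring, ← ih]
    field_simp
    ring

/-- Raising `j` by one multiplies the ratio of the two sides' factorials by `(n + j + 1) / (n - L +
j + 1)`, which is at least `exp(L / (n + j + 1))`, hence at least `exp(L / (2n))`. -/
lemma factorial_mul_exp_le (n L j : ℕ) (hL : L ≤ n) (hj : j ≤ L) :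
    (n.factorial : ℝ) * (n - L + j).factorial * Real.exp (L * j / (2 * n)) ≤
      (n - L).factorial * (n + j).factorial := by
  induction j with
  | zero => simp [mul_comm]
  | succ j ih =>
    specialize ih (by omega)
    have hn : (0 : ℝ) < n := by
      have : 0 < n := by omega
      exact_mod_cast this
    have hjn : (j : ℝ) + 1 ≤ n := by
      have : j + 1 ≤ n := by omega
      exact_mod_cast this
    have hstep : ((n : ℝ) - L + j + 1) * Real.exp (L / (2 * n)) ≤ n + j + 1 := by
      have h1 := Real.add_one_le_exp (-((L : ℝ) / (n + j + 1)))
      have hp : (0 : ℝ) < n + j + 1 := by positivity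
      have h2 : ((n : ℝ) - L + j + 1) = (n + j + 1) * (-((L : ℝ) / (n + j + 1)) + 1) := by
        field_simp
        ring
      have h3 : (L : ℝ) / (2 * n) ≤ L / (n + j + 1) := by
        apply div_le_div_of_nonneg_left (by positivity) hp
        linarith
      calc ((n : ℝ) - L + j + 1) * Real.exp (L / (2 * n))
          ≤ (n + j + 1) * Real.exp (-((L : ℝ) / (n + j + 1))) * Real.exp (L / (n + j + 1)) := by
            rw [h2]
            gcongr
        _ = n + j + 1 := by
            rw [mul_assoc, ← Real.exp_add, neg_add_cancel, Real.exp_zero, mul_one]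
    rw [← add_assoc, ← add_assoc, Nat.factorial_succ, Nat.factorial_succ]
    have hexp : Real.exp (L * ((j + 1 : ℕ) : ℝ) / (2 * n)) =
        Real.exp (L * j / (2 * n)) * Real.exp (L / (2 * n)) := by
      rw [← Real.exp_add]
      congr 1
      push_cast
      ring
    rw [hexp]
    push_cast [Nat.cast_sub hL]
    calc (n.factorial : ℝ) * (((n : ℝ) - L + j + 1) * (n - L + j).factorial) *
          (Real.exp (L * j / (2 * n)) * Real.exp (L / (2 * n)))
        = (n.factorial * (n - L + j).factorial * Real.exp (L * j / (2 * n))) *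
          (((n : ℝ) - L + j + 1) * Real.exp (L / (2 * n))) := by ring
      _ ≤ ((n - L).factorial * (n + j).factorial) * (n + j + 1) := by
          gcongr
          have : (L : ℝ) ≤ n := by exact_mod_cast hL
          have : (0 : ℝ) ≤ (n : ℝ) - L + j + 1 := by
            have : (0 : ℝ) ≤ j := by positivity
            linarith
          positivity
      _ = _ := by ring

lemma half_exp_le_prod_sq_sub_sq {l n : ℕ} (hl : l < n) :
    1 / 2 * Real.exp (((l : ℝ) + 1) ^ 2 / (2 * n)) ≤
      ∏ i ∈ Finset.range n, if i = l then (1 : ℝ) else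
        |((l : ℝ) + 1) ^ 2 - ((i : ℝ) + 1) ^ 2| / ((i : ℝ) + 1) ^ 2 := by
  obtain ⟨k, rfl⟩ : ∃ k, n = l + 1 + k := ⟨n - (l + 1), by omega⟩
  have h1 := prod_sq_sub_sq_eq l k
  have h2 := factorial_mul_exp_le (l + 1 + k) (l + 1) (l + 1) (by omega) le_rfl
  have e : l + 1 + k - (l + 1) = k := by omega
  rw [e, show k + (l + 1) = l + 1 + k by ring, ← h1] at h2
  have hf : (0 : ℝ) < ((l + 1 + k).factorial : ℝ) ^ 2 := by positivity
  have e2 : (((l + 1 : ℕ) : ℝ) * ((l + 1 : ℕ) : ℝ) / (2 * ((l + 1 + k : ℕ) : ℝ))) =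
      ((l : ℝ) + 1) ^ 2 / (2 * ((l + 1 + k : ℕ) : ℝ)) := by
    push_cast
    ring
  rw [e2] at h2
  refine le_of_mul_le_mul_right ?_ hf
  linarith

lemma half_le_prod_sq_sub_sq {l n : ℕ} (hl : l < n) :
    1 / 2 ≤ ∏ i ∈ Finset.range n, if i = l then (1 : ℝ) else
        |((l : ℝ) + 1) ^ 2 - ((i : ℝ) + 1) ^ 2| / ((i : ℝ) + 1) ^ 2 := by
  refine le_trans ?_ (half_exp_le_prod_sq_sub_sq hl)
  have : 1 ≤ Real.exp (((l : ℝ) + 1) ^ 2 / (2 * n)) := Real.one_le_exp (by positivity)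
  linarith

/-! ### The points below `w` and the cost of rounding them. -/

/-- The interpolation points below `w`. -/
def lowPoint (w b : ℕ) : ℕ := w / (100 * (b + 1) ^ 2)

lemma lowPoint_le (w b : ℕ) : (lowPoint w b : ℝ) ≤ w / (100 * ((b : ℝ) + 1) ^ 2) := by
  have := Nat.cast_div_le (α := ℝ) (m := w) (n := 100 * (b + 1) ^ 2)
  rw [lowPoint]
  push_cast at this
  exact this

lemma lt_lowPoint_add_one (w b : ℕ) :
    (w : ℝ) / (100 * ((b : ℝ) + 1) ^ 2) < lowPoint w b + 1 := by
  rw [div_lt_iff₀ (by positivity)]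
  have h := Nat.lt_div_mul_add (a := w) (b := 100 * (b + 1) ^ 2) (by positivity)
  have h' : w < (lowPoint w b + 1) * (100 * (b + 1) ^ 2) := by
    rw [lowPoint, add_mul, one_mul]
    exact h
  exact_mod_cast h'

/-- Rounding changes a distance between two low points by at most 1. Relative to the unrounded
distance this is at most `δ = 100 x^2 y / w`, where `x = l + 1` and `y = b + 1`, because `|x^2 -
y^2| ≥ y`. Then `1 - δ ≥ exp(-2δ)` for `δ ≤ 1/2` gives a form that multiplies well. -/
lemma lowPoint_gap {w B l b : ℕ} (hB : 400 * B ^ 3 ≤ w) (hl : l < B) (hb : b < B) (hne : b ≠ l) :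
    (w : ℝ) / (100 * ((l : ℝ) + 1) ^ 2) *
      (|((l : ℝ) + 1) ^ 2 - ((b : ℝ) + 1) ^ 2| / ((b : ℝ) + 1) ^ 2) *
      Real.exp (-(200 * ((l : ℝ) + 1) ^ 2 * (b + 1) / w)) ≤
      |(lowPoint w l : ℝ) - lowPoint w b| := by
  have hB0 : 0 < B := by omega
  have hw : (0 : ℝ) < w := by
    have : 0 < B ^ 3 := by positivity
    exact_mod_cast (show 0 < w by omega)
  have hBw : 400 * (B : ℝ) ^ 3 ≤ w := by exact_mod_cast hB
  have hx : (l : ℝ) + 1 ≤ B := by exact_mod_cast hl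
  have hy : (b : ℝ) + 1 ≤ B := by exact_mod_cast hb
  have hgap : (b : ℝ) + 1 ≤ |((l : ℝ) + 1) ^ 2 - ((b : ℝ) + 1) ^ 2| := by
    have h1 : (1 : ℝ) ≤ |(l : ℝ) - b| := by
      have : (1 : ℤ) ≤ |(l : ℤ) - b| := Int.one_le_abs (by omega)
      exact_mod_cast this
    rw [show ((l : ℝ) + 1) ^ 2 - ((b : ℝ) + 1) ^ 2 = ((l : ℝ) - b) * ((l + 1) + (b + 1)) by ring,
      abs_mul, abs_of_nonneg (by positivity : (0 : ℝ) ≤ (l + 1) + (b + 1))]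
    have : (0 : ℝ) ≤ l := by positivity
    have : (0 : ℝ) ≤ b := by positivity
    nlinarith
  set x : ℝ := (l : ℝ) + 1 with hxdef
  set y : ℝ := (b : ℝ) + 1 with hydef
  have hx0 : 0 < x := by positivity
  have hy0 : 0 < y := by positivity
  set G : ℝ := |x ^ 2 - y ^ 2| with hG
  have hG0 : 0 < G := hy0.trans_le hgap
  set δ : ℝ := 100 * x ^ 2 * y / w with hδ
  have hδ0 : 0 ≤ δ := by positivity
  have hδ1 : δ ≤ 1 / 2 := by
    rw [hδ, div_le_iff₀ hw]
    have : x ^ 2 * y ≤ (B : ℝ) ^ 2 * B := by gcongr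
    nlinarith
  have hτ : |(w : ℝ) / (100 * x ^ 2) - w / (100 * y ^ 2)| = w / (100 * x ^ 2) * (G / y ^ 2) := by
    have : (w : ℝ) / (100 * x ^ 2) - w / (100 * y ^ 2) =
        (w / (100 * x ^ 2) / y ^ 2) * (y ^ 2 - x ^ 2) := by
      field_simp
    rw [this, abs_mul, abs_of_nonneg (by positivity), abs_sub_comm]
    ring
  have h1 : w / (100 * x ^ 2) * (G / y ^ 2) - 1 ≤ |(lowPoint w l : ℝ) - lowPoint w b| := by
    rw [← hτ]
    have a1 := lowPoint_le w l
    have a2 := lowPoint_le w b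
    have a3 := lt_lowPoint_add_one w l
    have a4 := lt_lowPoint_add_one w b
    rw [← hxdef] at a1 a3
    rw [← hydef] at a2 a4
    rw [sub_le_iff_le_add, abs_le]
    have b1 := le_abs_self ((lowPoint w l : ℝ) - lowPoint w b)
    have b2 := neg_abs_le ((lowPoint w l : ℝ) - lowPoint w b)
    constructor <;> linarith
  have h2 : 1 ≤ w / (100 * x ^ 2) * (G / y ^ 2) * δ := by
    have : w / (100 * x ^ 2) * (G / y ^ 2) * δ = G / y := by
      rw [hδ]
      field_simp
    rw [this, le_div_iff₀ hy0, one_mul]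
    exact hgap
  have h3 : Real.exp (-(2 * δ)) ≤ 1 - δ := by
    rw [Real.exp_neg, inv_le_comm₀ (Real.exp_pos _) (by linarith)]
    refine le_trans ?_ (Real.add_one_le_exp _)
    rw [inv_le_iff_one_le_mul₀ (by linarith)]
    nlinarith
  have e : 200 * x ^ 2 * y / w = 2 * δ := by rw [hδ]; ring
  rw [e]
  have hM : 0 < w / (100 * x ^ 2) * (G / y ^ 2) := by positivity
  calc w / (100 * x ^ 2) * (G / y ^ 2) * Real.exp (-(2 * δ))
      ≤ w / (100 * x ^ 2) * (G / y ^ 2) * (1 - δ) := by gcongr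
    _ ≤ w / (100 * x ^ 2) * (G / y ^ 2) - 1 := by linarith
    _ ≤ _ := h1

lemma lowPoint_ne {w B l b : ℕ} (hB : 400 * B ^ 3 ≤ w) (hl : l < B) (hb : b < B) (hne : b ≠ l) :
    lowPoint w b ≠ lowPoint w l := by
  intro h
  have h1 := lowPoint_gap hB hl hb hne
  rw [h, sub_self, abs_zero] at h1
  have hw : (0 : ℝ) < w := by
    have : 0 < B ^ 3 := by have : 0 < B := by omega
                           positivity
    exact_mod_cast (show 0 < w by omega)
  have hx : ((l : ℝ) + 1) ^ 2 - ((b : ℝ) + 1) ^ 2 ≠ 0 := by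
    rw [show ((l : ℝ) + 1) ^ 2 - ((b : ℝ) + 1) ^ 2 = ((l : ℝ) - b) * ((l + 1) + (b + 1)) by ring]
    refine mul_ne_zero ?_ (by positivity)
    rw [sub_ne_zero]
    exact_mod_cast hne.symm
  have := abs_pos.mpr hx
  have h2 : 0 < (w : ℝ) / (100 * ((l : ℝ) + 1) ^ 2) *
      (|((l : ℝ) + 1) ^ 2 - ((b : ℝ) + 1) ^ 2| / ((b : ℝ) + 1) ^ 2) *
      Real.exp (-(200 * ((l : ℝ) + 1) ^ 2 * (b + 1) / w)) := by positivity
  linarith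

lemma lowPoint_pos {w B b : ℕ} (hB : 400 * B ^ 3 ≤ w) (hb : b < B) : 0 < lowPoint w b := by
  refine Nat.div_pos ?_ (by positivity)
  have h1 : (b + 1) ^ 2 ≤ B ^ 2 := Nat.pow_le_pow_left hb 2
  have h2 : B ^ 2 * 1 ≤ B ^ 2 * B := Nat.mul_le_mul_left _ (by omega)
  have h3 : B ^ 3 = B ^ 2 * B := by ring
  omega

/-- The rounding losses multiply to at least `exp(-(l+1)^2 / (2B))`, which is exactly the gain in
`half_exp_le_prod_sq_sub_sq`. Without that gain, the exponent of order `(l+1)^2 B^2 / w` would have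
to be bounded for `l` up to `B`, which asks for `w` of order `B^4`. -/
lemma half_pow_le_prod_lowPoint {w B l : ℕ} (hB : 400 * B ^ 3 ≤ w) (hl : l < B) :
    1 / 2 * (lowPoint w l : ℝ) ^ B ≤ lowPoint w l * ∏ b ∈ Finset.range B,
      if b = l then (1 : ℝ) else |(lowPoint w l : ℝ) - lowPoint w b| := by
  have hB0 : (0 : ℝ) < B := by
    have : 0 < B := by omega
    exact_mod_cast this
  have hw : (0 : ℝ) < w := by
    have : 0 < B ^ 3 := by have : 0 < B := by omega
                           positivity
    exact_mod_cast (show 0 < w by omega)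
  have hBw : 400 * (B : ℝ) ^ 3 ≤ w := by exact_mod_cast hB
  set t : ℝ := (lowPoint w l : ℝ) with ht
  have ht0 : 0 < t := Nat.cast_pos.mpr (lowPoint_pos hB hl)
  set r : ℕ → ℝ := fun b => |((l : ℝ) + 1) ^ 2 - ((b : ℝ) + 1) ^ 2| / ((b : ℝ) + 1) ^ 2 with hr
  set ε : ℕ → ℝ := fun b => -(200 * ((l : ℝ) + 1) ^ 2 * (b + 1) / w) with hε
  have hfac : ∏ b ∈ Finset.range B, ((if b = l then 1 else t) * (if b = l then 1 else r b) *
      Real.exp (ε b)) ≤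
      ∏ b ∈ Finset.range B, if b = l then (1 : ℝ) else |t - lowPoint w b| := by
    refine Finset.prod_le_prod (fun b _ => ?_) fun b hb => ?_
    · split_ifs <;> positivity
    · split_ifs with h
      · rw [one_mul, one_mul, Real.exp_le_one_iff]
        simp only [hε, Left.neg_nonpos_iff]
        positivity
      · refine le_trans ?_ (lowPoint_gap hB hl (Finset.mem_range.mp hb) h)
        -- Rounding down gives `t ≤ w / (100 (l+1)^2)`, so the prefactor in `lowPoint_gap` may be
        -- replaced by `t`.
        have := lowPoint_le w l
        gcongr
  rw [Finset.prod_mul_distrib, Finset.prod_mul_distrib, ← Real.exp_sum] at hfac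
  have h1 := prod_range_ite_mul hl (fun _ => t)
  rw [Finset.prod_const, Finset.card_range] at h1
  have h2 := half_exp_le_prod_sq_sub_sq hl
  -- The total loss is at most `200 (l+1)^2 B^2 / w`; comparing it with `(l+1)^2 / (2B)` is exactly
  -- the hypothesis `400 B^3 ≤ w`.
  have h3 : -(((l : ℝ) + 1) ^ 2 / (2 * B)) ≤ ∑ b ∈ Finset.range B, ε b := by
    have hs : ∑ b ∈ Finset.range B, (200 * ((l : ℝ) + 1) ^ 2 * (b + 1) / w) ≤
        ∑ b ∈ Finset.range B, (200 * ((l : ℝ) + 1) ^ 2 * B / w) := by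
      refine Finset.sum_le_sum fun b hb => ?_
      have : (b : ℝ) + 1 ≤ B := by exact_mod_cast Finset.mem_range.mp hb
      gcongr
    rw [Finset.sum_const, Finset.card_range, nsmul_eq_mul] at hs
    rw [hε, Finset.sum_neg_distrib, neg_le_neg_iff]
    refine hs.trans ?_
    rw [mul_div_assoc', div_le_div_iff₀ hw (by positivity)]
    have : (0 : ℝ) ≤ ((l : ℝ) + 1) ^ 2 := by positivity
    nlinarith
  calc 1 / 2 * t ^ B = t ^ B * (1 / 2 * Real.exp (((l : ℝ) + 1) ^ 2 / (2 * B))) *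
        Real.exp (-(((l : ℝ) + 1) ^ 2 / (2 * B))) := by
        rw [mul_assoc, mul_assoc, ← Real.exp_add, add_neg_cancel, Real.exp_zero]
        ring
    _ ≤ t ^ B * (∏ b ∈ Finset.range B, if b = l then 1 else r b) *
        Real.exp (∑ b ∈ Finset.range B, ε b) := by gcongr
    _ = t * ((∏ b ∈ Finset.range B, if b = l then 1 else t) *
        (∏ b ∈ Finset.range B, if b = l then 1 else r b) *
        Real.exp (∑ b ∈ Finset.range B, ε b)) := by rw [← h1]; ring
    _ ≤ _ := by gcongr

/-! ### The points above `2w`, and products of distances between scales. -/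

/-- The interpolation points above `2 * w`. -/
def highPoint (w a : ℕ) : ℕ := 100 * w * (a + 1) ^ 2

lemma highPoint_cast (w a : ℕ) : (highPoint w a : ℝ) = 100 * w * ((a : ℝ) + 1) ^ 2 := by
  simp [highPoint]

lemma le_highPoint (w a : ℕ) : 100 * (w : ℝ) ≤ highPoint w a := by
  rw [highPoint_cast]
  have h : (1 : ℝ) ≤ ((a : ℝ) + 1) ^ 2 := one_le_pow₀ (by simp)
  nlinarith [(Nat.cast_nonneg w : (0 : ℝ) ≤ w)]

lemma lowPoint_le_div (w b : ℕ) : 100 * (lowPoint w b : ℝ) ≤ w := by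
  have h := lowPoint_le w b
  rw [le_div_iff₀ (by positivity)] at h
  have h1 : (1 : ℝ) ≤ ((b : ℝ) + 1) ^ 2 := one_le_pow₀ (by simp)
  nlinarith [(Nat.cast_nonneg (lowPoint w b) : (0 : ℝ) ≤ lowPoint w b)]

/-- For a point `x ≥ w`, the low interpolation points contribute almost as if they were `0`. -/
lemma half_pow_le_prod_sub_lowPoint {w : ℕ} (hw : 0 < w) (B : ℕ) {x : ℝ} (hx : (w : ℝ) ≤ x) :
    1 / 2 * x ^ B ≤ ∏ b ∈ Finset.range B, (x - lowPoint w b) := by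
  have hw' : (0 : ℝ) < w := by exact_mod_cast hw
  have hx0 : 0 < x := hw'.trans_le hx
  have h := half_le_prod_one_sub B (fun b => lowPoint w b / x) (fun b => by positivity) fun b => by
    rw [div_le_iff₀ hx0]
    refine (lowPoint_le w b).trans ?_
    rw [one_div, inv_mul_eq_div]
    gcongr
  have e : ∏ b ∈ Finset.range B, (x - lowPoint w b) =
      x ^ B * ∏ b ∈ Finset.range B, (1 - lowPoint w b / x) := by
    rw [← Finset.card_range B, ← Finset.prod_const, Finset.card_range, ← Finset.prod_mul_distrib]
    refine Finset.prod_congr rfl fun b _ => ?_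
    field_simp
  rw [e, mul_comm]
  gcongr

/-- For a point `x ≤ w`, the high interpolation points contribute almost as they do at `0`. -/
lemma half_prod_le_prod_highPoint_sub {w : ℕ} (hw : 0 < w) (A : ℕ) {x : ℝ} (hx0 : 0 ≤ x)
    (hx : x ≤ w) : 1 / 2 * ∏ a ∈ Finset.range A, (highPoint w a : ℝ) ≤
      ∏ a ∈ Finset.range A, (highPoint w a - x) := by
  have hw' : (0 : ℝ) < w := by exact_mod_cast hw
  have hs : ∀ a, (0 : ℝ) < highPoint w a := fun a => by linarith [le_highPoint w a]
  have h := half_le_prod_one_sub A (fun a => x / highPoint w a)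
    (fun a => div_nonneg hx0 (hs a).le) fun a => by
    rw [highPoint_cast, div_le_div_iff₀ (by positivity) (by positivity)]
    have : (0 : ℝ) ≤ 100 * ((a : ℝ) + 1) ^ 2 := by positivity
    nlinarith
  have e : ∏ a ∈ Finset.range A, ((highPoint w a : ℝ) - x) =
      (∏ a ∈ Finset.range A, (highPoint w a : ℝ)) *
        ∏ a ∈ Finset.range A, (1 - x / highPoint w a) := by
    rw [← Finset.prod_mul_distrib]
    refine Finset.prod_congr rfl fun a _ => ?_
    have := (hs a).ne'
    field_simp
  have hP : 0 ≤ ∏ a ∈ Finset.range A, (highPoint w a : ℝ) :=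
    Finset.prod_nonneg fun a _ => (hs a).le
  rw [e, mul_comm]
  gcongr

/-- The high points are integers without rounding, so the common factor `100 w` cancels and the
plain bound `1/2` on products over squares is enough. -/
lemma half_prod_le_prod_highPoint {w : ℕ} (hw : 0 < w) {A l : ℕ} (hl : l < A) :
    1 / 2 * ∏ a ∈ Finset.range A, (highPoint w a : ℝ) ≤ highPoint w l *
      ∏ a ∈ Finset.range A, if a = l then (1 : ℝ) else |(highPoint w l : ℝ) - highPoint w a| := by
  have hw' : (0 : ℝ) < w := by exact_mod_cast hw
  have hs : ∀ a, (0 : ℝ) < highPoint w a := fun a => by linarith [le_highPoint w a]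
  have e : (∏ a ∈ Finset.range A, if a = l then (1 : ℝ) else
        |(highPoint w l : ℝ) - highPoint w a|) =
      (∏ a ∈ Finset.range A, if a = l then (1 : ℝ) else highPoint w a) *
        ∏ a ∈ Finset.range A, if a = l then (1 : ℝ) else
        |((l : ℝ) + 1) ^ 2 - ((a : ℝ) + 1) ^ 2| / ((a : ℝ) + 1) ^ 2 := by
    rw [← Finset.prod_mul_distrib]
    refine Finset.prod_congr rfl fun a _ => ?_
    split_ifs
    · rw [one_mul]
    · rw [highPoint_cast, highPoint_cast, ← mul_sub, abs_mul, abs_of_nonneg (by positivity)]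
      field_simp
  have hP : 0 ≤ ∏ a ∈ Finset.range A, (highPoint w a : ℝ) :=
    Finset.prod_nonneg fun a _ => (hs a).le
  rw [e, ← mul_assoc, mul_comm ((highPoint w l : ℝ)),
    prod_range_ite_mul hl (fun a => (highPoint w a : ℝ)), mul_comm]
  gcongr
  exact half_le_prod_sq_sub_sq hl

/-! ### Nodes and weights of the divided difference. -/

/-- Index set of the interpolation points `w`, `2 * w`, the high points and the low points. -/
def nodeIndex (A B : ℕ) : Finset (Bool ⊕ (ℕ ⊕ ℕ)) :=
  Finset.univ.disjSum ((Finset.range A).disjSum (Finset.range B))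

/-- The interpolation points. -/
def node (w : ℕ) : Bool ⊕ (ℕ ⊕ ℕ) → ℕ
  | .inl false => w
  | .inl true => 2 * w
  | .inr (.inl a) => highPoint w a
  | .inr (.inr b) => lowPoint w b

lemma card_nodeIndex (A B : ℕ) : (nodeIndex A B).card = 2 + (A + B) := by
  simp [nodeIndex]

lemma node_pos {w A B : ℕ} (hw : 0 < w) (hB : 400 * B ^ 3 ≤ w) {i : Bool ⊕ (ℕ ⊕ ℕ)}
    (hi : i ∈ nodeIndex A B) : 1 ≤ node w i := by
  rcases i with (_ | _) | a | b
  · exact hw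
  · simp only [node]; omega
  · simp only [node, highPoint]; exact Nat.one_le_iff_ne_zero.mpr (by positivity)
  · simp only [nodeIndex, Finset.inr_mem_disjSum, Finset.mem_range] at hi
    exact lowPoint_pos hB hi

lemma node_le {w A B N : ℕ} (h2w : 2 * w ≤ N) (hA : 100 * w * A ^ 2 ≤ N)
    {i : Bool ⊕ (ℕ ⊕ ℕ)} (hi : i ∈ nodeIndex A B) : node w i ≤ N := by
  rcases i with (_ | _) | a | b
  · simp only [node]; omega
  · exact h2w
  · simp only [nodeIndex, Finset.inr_mem_disjSum, Finset.inl_mem_disjSum, Finset.mem_range] at hi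
    exact (Nat.mul_le_mul_left _ (Nat.pow_le_pow_left hi 2)).trans hA
  · have : lowPoint w b ≤ w := Nat.div_le_self _ _
    simp only [node]; omega

lemma node_injOn {w A B : ℕ} (hw : 0 < w) (hB : 400 * B ^ 3 ≤ w) :
    Set.InjOn (node w) (nodeIndex A B) := by
  have hs : ∀ a, 100 * w ≤ highPoint w a := fun a => by exact_mod_cast le_highPoint w a
  have ht : ∀ b, 100 * lowPoint w b ≤ w := fun b => by exact_mod_cast lowPoint_le_div w b
  intro i hi j hj hij
  rcases i with (_ | _) | a | b <;> rcases j with (_ | _) | a' | b' <;>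
    simp only [node] at hij
  any_goals rfl
  any_goals omega
  any_goals (have := hs a; omega)
  any_goals (have := hs a'; omega)
  any_goals (have := ht b; omega)
  any_goals (have := ht b'; omega)
  · simp only [highPoint] at hij
    have h := Nat.eq_of_mul_eq_mul_left (by positivity) hij
    have h' := Nat.pow_left_injective (two_ne_zero) h
    simp only [add_left_inj] at h'
    rw [h']
  · have := hs a; have := ht b'; omega
  · have := hs a'; have := ht b; omega
  · by_contra hne
    simp only [nodeIndex, Finset.mem_coe, Finset.inr_mem_disjSum, Finset.mem_range] at hi hj
    refine lowPoint_ne hB hj hi ?_ hij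
    rintro rfl
    exact hne rfl

/-- The product of the differences of a node with the other nodes. -/
def nodeDiff (w A B : ℕ) (i : Bool ⊕ (ℕ ⊕ ℕ)) : ℝ :=
  ∏ j ∈ (nodeIndex A B).erase i, ((node w i : ℝ) - node w j)

lemma nodeDiff_eq (w A B : ℕ) {i : Bool ⊕ (ℕ ⊕ ℕ)} (hi : i ∈ nodeIndex A B) :
    nodeDiff w A B i = (∏ c, if Sum.inl c = i then (1 : ℝ) else node w i - node w (.inl c)) *
      ((∏ a ∈ Finset.range A, if Sum.inr (.inl a) = i then (1 : ℝ) else node w i - highPoint w a) *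
      ∏ b ∈ Finset.range B, if Sum.inr (.inr b) = i then (1 : ℝ) else node w i - lowPoint w b) := by
  have h : nodeDiff w A B i = ∏ j ∈ nodeIndex A B, if j = i then (1 : ℝ) else
      (node w i : ℝ) - node w j := by
    rw [← Finset.prod_erase_mul _ _ hi, if_pos rfl, mul_one, nodeDiff]
    exact Finset.prod_congr rfl fun j hj => (if_neg (Finset.ne_of_mem_erase hj)).symm
  rw [h, nodeIndex, Finset.prod_disjSum, Finset.prod_disjSum]
  rfl

/-- The normalization of the dual weights. -/
def highProd (w A : ℕ) : ℝ := ∏ a ∈ Finset.range A, (highPoint w a : ℝ)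

lemma highProd_pos {w : ℕ} (hw : 0 < w) (A : ℕ) : 0 < highProd w A := by
  refine Finset.prod_pos fun a _ => ?_
  have := le_highPoint w a
  have : (0 : ℝ) < w := by exact_mod_cast hw
  linarith

/-- Used at `x = w` and `x = 2w`, whose mutual distance is the factor `w`. Each high point
contributes at most its own value and each low point at most `x`, so the powers `x ^ B` cancel. -/
lemma le_pow_div_prod {w : ℕ} (hw : 0 < w) (A B : ℕ) {x : ℝ} (hx : (w : ℝ) ≤ x)
    (hx2 : x ≤ 2 * w) : 1 / (w * highProd w A) ≤ x ^ B / (w *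
      ((∏ a ∈ Finset.range A, (highPoint w a - x)) * ∏ b ∈ Finset.range B, (x - lowPoint w b))) := by
  have hw' : (0 : ℝ) < w := by exact_mod_cast hw
  have h1 : 0 < ∏ a ∈ Finset.range A, ((highPoint w a : ℝ) - x) :=
    Finset.prod_pos fun a _ => by linarith [le_highPoint w a]
  have h2 : ∏ a ∈ Finset.range A, ((highPoint w a : ℝ) - x) ≤ highProd w A :=
    Finset.prod_le_prod (fun a _ => by linarith [le_highPoint w a]) fun a _ => by linarith
  have h3 : 0 < ∏ b ∈ Finset.range B, (x - lowPoint w b) :=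
    Finset.prod_pos fun b _ => by linarith [lowPoint_le_div w b]
  have h4 : ∏ b ∈ Finset.range B, (x - lowPoint w b) ≤ x ^ B := by
    rw [← Finset.card_range B, ← Finset.prod_const, Finset.card_range]
    exact Finset.prod_le_prod (fun b _ => by linarith [lowPoint_le_div w b])
      fun b _ => by linarith [(Nat.cast_nonneg (lowPoint w b) : (0 : ℝ) ≤ lowPoint w b)]
  have h5 := highProd_pos hw A
  rw [div_le_div_iff₀ (by positivity) (by positivity), one_mul]
  calc (w : ℝ) * ((∏ a ∈ Finset.range A, ((highPoint w a : ℝ) - x)) *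
        ∏ b ∈ Finset.range B, (x - lowPoint w b))
      ≤ w * (highProd w A * x ^ B) := by gcongr
    _ = _ := by ring

/-- The `A` high points give the sign `(-1)^A`; the extra minus sign is that of `w - 2w`, and it is
what opposes this weight to the one at `2w`. -/
lemma exists_weight_w {w : ℕ} (hw : 0 < w) (A B : ℕ) :
    ∃ α : ℝ, 1 / (w * highProd w A) ≤ α ∧
      (w : ℝ) ^ B / nodeDiff w A B (.inl false) = -((-1) ^ A * α) := by
  have hw' : (0 : ℝ) < w := by exact_mod_cast hw
  refine ⟨_, le_pow_div_prod hw A B le_rfl (by linarith), ?_⟩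
  have h : nodeDiff w A B (.inl false) = -(-1) ^ A * (w *
      ((∏ a ∈ Finset.range A, (highPoint w a - (w : ℝ))) *
        ∏ b ∈ Finset.range B, ((w : ℝ) - lowPoint w b))) := by
    have e : ∏ a ∈ Finset.range A, ((w : ℝ) - highPoint w a) =
        (-1) ^ A * ∏ a ∈ Finset.range A, (highPoint w a - (w : ℝ)) := by
      rw [← Finset.card_range A, ← Finset.prod_const, Finset.card_range,
        ← Finset.prod_mul_distrib]
      exact Finset.prod_congr rfl fun a _ => by ring
    rw [nodeDiff_eq w A B (by simp [nodeIndex])]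
    simp [node, e]
    ring
  rw [h]
  rcases neg_one_pow_eq_or ℝ A with h1 | h1 <;> rw [h1] <;> simp [div_neg]

lemma exists_weight_two_mul_w {w : ℕ} (hw : 0 < w) (A B : ℕ) :
    ∃ β : ℝ, 1 / (w * highProd w A) ≤ β ∧
      (2 * w : ℝ) ^ B / nodeDiff w A B (.inl true) = (-1) ^ A * β := by
  have hw' : (0 : ℝ) < w := by exact_mod_cast hw
  refine ⟨_, le_pow_div_prod hw A B (by linarith : (w : ℝ) ≤ 2 * w) le_rfl, ?_⟩
  have h : nodeDiff w A B (.inl true) = (-1) ^ A * (w *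
      ((∏ a ∈ Finset.range A, (highPoint w a - 2 * (w : ℝ))) *
        ∏ b ∈ Finset.range B, (2 * (w : ℝ) - lowPoint w b))) := by
    have e : ∏ a ∈ Finset.range A, (2 * (w : ℝ) - highPoint w a) =
        (-1) ^ A * ∏ a ∈ Finset.range A, (highPoint w a - 2 * (w : ℝ)) := by
      rw [← Finset.card_range A, ← Finset.prod_const, Finset.card_range,
        ← Finset.prod_mul_distrib]
      exact Finset.prod_congr rfl fun a _ => by ring
    rw [nodeDiff_eq w A B (by simp [nodeIndex])]
    simp [node, e]
    ring
  rw [h]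
  rcases neg_one_pow_eq_or ℝ A with h1 | h1 <;> rw [h1] <;> simp [div_neg]

/-- The distances to `w` and `2w` contribute about `s^2`, the other high points at least `highProd /
(2s)`, the low points at least `s^B / 2`. The weight is thus of order `1 / (s * highProd)`, and `s =
100 w (l+1)^2` supplies both the small constant and the decay. -/
lemma abs_weight_high_le {w : ℕ} (hw : 0 < w) {A B l : ℕ} (hl : l < A) :
    |(highPoint w l : ℝ) ^ B / nodeDiff w A B (.inr (.inl l))| ≤
      1 / (w * highProd w A) * (1 / 20 * (1 / ((l : ℝ) + 1) ^ 2)) := by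
  have hw' : (0 : ℝ) < w := by exact_mod_cast hw
  set s : ℝ := (highPoint w l : ℝ) with hs
  have hsw : 100 * (w : ℝ) ≤ s := le_highPoint w l
  have hs0 : 0 < s := by linarith
  have hP := highProd_pos hw A
  set X := ∏ a ∈ Finset.range A, if a = l then (1 : ℝ) else |s - highPoint w a| with hX
  set Y := ∏ b ∈ Finset.range B, (s - lowPoint w b) with hY
  have h : |nodeDiff w A B (.inr (.inl l))| = (s - w) * (s - 2 * w) * X * Y := by
    have e1 : |∏ a ∈ Finset.range A, if a = l then (1 : ℝ) else s - highPoint w a| = X := by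
      rw [Finset.abs_prod]
      refine Finset.prod_congr rfl fun a _ => ?_
      split_ifs <;> simp
    have e2 : |Y| = Y :=
      abs_of_nonneg (Finset.prod_nonneg fun b _ => by linarith [lowPoint_le_div w b])
    rw [nodeDiff_eq w A B (by simp [nodeIndex, hl]), abs_mul, abs_mul]
    simp only [Sum.inr.injEq, Sum.inl.injEq, reduceCtorEq, if_false, node, Fintype.prod_bool,
      ← hs]
    rw [e1, ← hY, e2, abs_mul]
    push_cast
    rw [abs_of_nonneg (by linarith : 0 ≤ s - 2 * w), abs_of_nonneg (by linarith : 0 ≤ s - w)]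
    ring
  have hXb : 1 / 2 * highProd w A ≤ s * X := half_prod_le_prod_highPoint hw hl
  have hYb : 1 / 2 * s ^ B ≤ Y := half_pow_le_prod_sub_lowPoint hw B (by linarith)
  have hX0 : 0 < X := by
    by_contra hc
    have : s * X ≤ 0 := mul_nonpos_of_nonneg_of_nonpos hs0.le (not_lt.mp hc)
    linarith
  have hY0 : 0 < Y := lt_of_lt_of_le (by positivity) hYb
  -- Expand and use `3 w s ≤ 3 s^2 / 100`.
  have hq : 97 / 100 * s ^ 2 ≤ (s - w) * (s - 2 * w) := by nlinarith
  have hsl : s = 100 * w * ((l : ℝ) + 1) ^ 2 := highPoint_cast w l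
  rw [abs_div, h, abs_of_nonneg (by positivity : 0 ≤ s ^ B)]
  have hD : 97 / 400 * s * highProd w A * s ^ B ≤ (s - w) * (s - 2 * w) * X * Y := by
    calc 97 / 400 * s * highProd w A * s ^ B
        = 97 / 100 * s * (1 / 2 * highProd w A) * (1 / 2 * s ^ B) := by ring
      _ ≤ 97 / 100 * s * (s * X) * Y := by gcongr
      _ = 97 / 100 * s ^ 2 * X * Y := by ring
      _ ≤ _ := by gcongr
  calc s ^ B / ((s - w) * (s - 2 * w) * X * Y)
      ≤ s ^ B / (97 / 400 * s * highProd w A * s ^ B) := by gcongr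
    _ = 400 / (97 * s * highProd w A) := by field_simp
    _ = 4 / 97 * (1 / (w * highProd w A) * (1 / ((l : ℝ) + 1) ^ 2)) := by
        rw [hsl]
        field_simp
        norm_num
    _ ≤ 1 / 20 * (1 / (w * highProd w A) * (1 / ((l : ℝ) + 1) ^ 2)) := by
        exact mul_le_mul_of_nonneg_right (by norm_num) (by positivity)
    _ = _ := by ring

/-- Here the weight is at most `4 t / (w^2 * highProd)`, and the smallness comes from `t ≤ w / (100
(l+1)^2)`. -/
lemma abs_weight_low_le {w : ℕ} (hw : 0 < w) {A B l : ℕ} (hB : 400 * B ^ 3 ≤ w) (hl : l < B) :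
    |(lowPoint w l : ℝ) ^ B / nodeDiff w A B (.inr (.inr l))| ≤
      1 / (w * highProd w A) * (1 / 20 * (1 / ((l : ℝ) + 1) ^ 2)) := by
  have hw' : (0 : ℝ) < w := by exact_mod_cast hw
  have ht0 : (0 : ℝ) < lowPoint w l := by exact_mod_cast lowPoint_pos hB hl
  have hXb := half_pow_le_prod_lowPoint hB hl
  have htl := lowPoint_le w l
  have htw : 100 * (lowPoint w l : ℝ) ≤ w := lowPoint_le_div w l
  set t : ℝ := (lowPoint w l : ℝ) with ht
  have hP := highProd_pos hw A
  set X := ∏ b ∈ Finset.range B, if b = l then (1 : ℝ) else |t - lowPoint w b| with hX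
  set Y := ∏ a ∈ Finset.range A, (highPoint w a - t) with hY
  have h : |nodeDiff w A B (.inr (.inr l))| = (w - t) * (2 * w - t) * X * Y := by
    have e1 : |∏ b ∈ Finset.range B, if b = l then (1 : ℝ) else t - lowPoint w b| = X := by
      rw [Finset.abs_prod]
      refine Finset.prod_congr rfl fun a _ => ?_
      split_ifs <;> simp
    have e2 : |∏ a ∈ Finset.range A, (t - highPoint w a)| = Y := by
      rw [Finset.abs_prod]
      refine Finset.prod_congr rfl fun a _ => ?_
      rw [abs_sub_comm, abs_of_nonneg]
      linarith [le_highPoint w a]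
    rw [nodeDiff_eq w A B (by simp [nodeIndex, hl]), abs_mul, abs_mul]
    simp only [Sum.inr.injEq, reduceCtorEq, if_false, node, Fintype.prod_bool, ← ht]
    rw [e1, e2, abs_mul]
    push_cast
    rw [abs_sub_comm, abs_sub_comm t w, abs_of_nonneg (by linarith : 0 ≤ 2 * w - t),
      abs_of_nonneg (by linarith : 0 ≤ w - t)]
    ring
  have hYb : 1 / 2 * highProd w A ≤ Y := half_prod_le_prod_highPoint_sub hw A ht0.le (by linarith)
  have hX0 : 0 < X := by
    by_contra hc
    have h1 : t * X ≤ 0 := mul_nonpos_of_nonneg_of_nonpos ht0.le (not_lt.mp hc)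
    have h2 : 0 < t ^ B := by positivity
    linarith
  have hY0 : 0 < Y := lt_of_lt_of_le (by positivity) hYb
  have hq : (w : ℝ) ^ 2 ≤ (w - t) * (2 * w - t) := by nlinarith
  rw [abs_div, h, abs_of_nonneg (by positivity : 0 ≤ t ^ B)]
  have hD : w ^ 2 * (1 / 2 * t ^ B / t) * (1 / 2 * highProd w A) ≤
      (w - t) * (2 * w - t) * X * Y := by
    have : 1 / 2 * t ^ B / t ≤ X := by
      rw [div_le_iff₀ ht0]
      linarith
    have h1 : 0 < w - t := by linarith
    have h2 : 0 < 2 * w - t := by linarith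
    gcongr
  calc t ^ B / ((w - t) * (2 * w - t) * X * Y)
      ≤ t ^ B / (w ^ 2 * (1 / 2 * t ^ B / t) * (1 / 2 * highProd w A)) := by gcongr
    _ = 4 / (w ^ 2 * highProd w A) * t := by
        field_simp
        norm_num
    _ ≤ 4 / (w ^ 2 * highProd w A) * (w / (100 * ((l : ℝ) + 1) ^ 2)) := by gcongr
    _ = 1 / 25 * (1 / (w * highProd w A) * (1 / ((l : ℝ) + 1) ^ 2)) := by
        field_simp
        norm_num
    _ ≤ 1 / 20 * (1 / (w * highProd w A) * (1 / ((l : ℝ) + 1) ^ 2)) := by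
        gcongr
        norm_num
    _ = _ := by ring

/-- By Lagrange interpolation on `A + B + 2` nodes, the sum is the coefficient of `P` in degree `A +
B + 1`, which vanishes. -/
lemma sum_weight_eq_zero {w A B : ℕ} (hw : 0 < w) (hB : 400 * B ^ 3 ≤ w) {g : ℕ → ℝ}
    {P : Polynomial ℂ} (hP : P.natDegree ≤ A + B)
    (hg : ∀ i ∈ nodeIndex A B, P.eval (node w i : ℂ) = (node w i : ℂ) ^ B * (g (node w i) : ℂ)) :
    ∑ i ∈ nodeIndex A B, (node w i : ℝ) ^ B / nodeDiff w A B i * g (node w i) = 0 := by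
  have hinj : Set.InjOn (fun i => (node w i : ℂ)) (nodeIndex A B) := fun i hi j hj hij =>
    node_injOn hw hB hi hj (Nat.cast_injective hij)
  have hdeg : P.degree < (nodeIndex A B).card := by
    refine Polynomial.degree_le_natDegree.trans_lt ?_
    rw [card_nodeIndex]
    exact_mod_cast (by omega : P.natDegree < 2 + (A + B))
  have h := Lagrange.coeff_eq_sum hinj hdeg
  rw [card_nodeIndex, Polynomial.coeff_eq_zero_of_natDegree_lt (by omega)] at h
  have h' : ((∑ i ∈ nodeIndex A B, (node w i : ℝ) ^ B / nodeDiff w A B i * g (node w i) : ℝ) : ℂ)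
      = 0 := by
    rw [h, Complex.ofReal_sum]
    refine Finset.sum_congr rfl fun i hi => ?_
    rw [hg i hi, nodeDiff]
    push_cast
    ring
  exact_mod_cast h'

/-! ### Impossibility for bounded Laurent polynomials. -/

/-- A Laurent polynomial with exponents in `[-B, A]` that is bounded by `[0, 1]` on `{1, …, N}`
cannot distinguish `w` from `2 * w` if `A = O(√(N / w))` and `B = O(w^{1/3})`. -/
theorem not_laurent_approximation {N w A B : ℕ} (hw : 0 < w) (h2w : 2 * w ≤ N)
    (hA : 100 * w * A ^ 2 ≤ N) (hB : 400 * B ^ 3 ≤ w) {q : ℕ → ℝ}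
    (hq : ∀ k, 1 ≤ k → k ≤ N → 0 ≤ q k ∧ q k ≤ 1) {P : Polynomial ℂ} (hP : P.natDegree ≤ A + B)
    (hPq : ∀ k : ℕ, 1 ≤ k → k ≤ N → P.eval (k : ℂ) = (k : ℂ) ^ B * (q k : ℂ))
    (hqw : q w ≤ 1 / 3) (hq2w : 2 / 3 ≤ q (2 * w)) : False := by
  have hmem : ∀ i ∈ nodeIndex A B, 1 ≤ node w i ∧ node w i ≤ N := fun i hi =>
    ⟨node_pos hw hB hi, node_le h2w hA hi⟩
  -- Centring at `1/2` leaves `|q - 1/2| ≤ 1/2` at every node, while both values at `w` and `2w`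
  -- then contribute at least `1/6` with the same sign.
  have hsum := sum_weight_eq_zero (P := P - Polynomial.C (1 / 2) * Polynomial.X ^ B)
    (g := fun k => q k - 1 / 2) (A := A) hw hB
    ((Polynomial.natDegree_sub_le _ _).trans (max_le hP
      ((Polynomial.natDegree_C_mul_X_pow_le _ _).trans (by omega)))) (by
      intro i hi
      rw [Polynomial.eval_sub, hPq _ (hmem i hi).1 (hmem i hi).2]
      simp only [Polynomial.eval_mul, Polynomial.eval_C, Polynomial.eval_pow, Polynomial.eval_X]
      push_cast
      ring)
  rw [nodeIndex, Finset.sum_disjSum, Finset.sum_disjSum, Fintype.sum_bool] at hsum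
  simp only [node] at hsum
  obtain ⟨α, hα, hα'⟩ := exists_weight_w hw A B
  obtain ⟨β, hβ, hβ'⟩ := exists_weight_two_mul_w hw A B
  push_cast at hsum
  rw [hα', hβ'] at hsum
  set c : ℝ := 1 / (w * highProd w A) with hc
  have hc0 : 0 < c := by
    have := highProd_pos hw A
    have : (0 : ℝ) < w := by exact_mod_cast hw
    positivity
  have hbound : ∀ (n : ℕ) (f : ℕ → ℝ) (p : ℕ → ℕ),
      (∀ l < n, |f l| ≤ c * (1 / 20 * (1 / ((l : ℝ) + 1) ^ 2))) →
      (∀ l < n, 1 ≤ p l ∧ p l ≤ N) →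
      |∑ l ∈ Finset.range n, f l * (q (p l) - 1 / 2)| ≤ c * (1 / 20) := by
    intro n f p hf hp
    calc |∑ l ∈ Finset.range n, f l * (q (p l) - 1 / 2)|
        ≤ ∑ l ∈ Finset.range n, |f l * (q (p l) - 1 / 2)| := Finset.abs_sum_le_sum_abs _ _
      _ ≤ ∑ l ∈ Finset.range n, c * (1 / 40) * (1 / ((l : ℝ) + 1) ^ 2) := by
          refine Finset.sum_le_sum fun l hl => ?_
          have hl' := Finset.mem_range.mp hl
          have h1 := hf l hl'
          have h2 : |q (p l) - 1 / 2| ≤ 1 / 2 := by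
            have := hq (p l) (hp l hl').1 (hp l hl').2
            rw [abs_le]
            constructor <;> linarith
          rw [abs_mul]
          calc |f l| * |q (p l) - 1 / 2|
              ≤ c * (1 / 20 * (1 / ((l : ℝ) + 1) ^ 2)) * (1 / 2) := by gcongr
            _ = _ := by ring
      _ ≤ c * (1 / 40) * 2 := by
          rw [← Finset.mul_sum]
          gcongr
          exact sum_one_div_sq_le n
      _ = _ := by ring
  have hhigh := hbound A (fun a => (highPoint w a : ℝ) ^ B / nodeDiff w A B (.inr (.inl a)))
    (highPoint w) (fun l hl => abs_weight_high_le hw hl)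
    (fun l hl => hmem (.inr (.inl l)) (by simpa [nodeIndex] using hl))
  have hlow := hbound B (fun b => (lowPoint w b : ℝ) ^ B / nodeDiff w A B (.inr (.inr b)))
    (lowPoint w) (fun l hl => abs_weight_low_le hw hB hl)
    (fun l hl => hmem (.inr (.inr l)) (by simpa [nodeIndex] using hl))
  have hmain : c * (1 / 3) ≤ β * (q (2 * w) - 1 / 2) + α * (1 / 2 - q w) := by
    nlinarith [mul_le_mul hβ (by linarith : (1 : ℝ) / 6 ≤ q (2 * w) - 1 / 2) (by norm_num)
      (hc0.le.trans hβ), mul_le_mul hα (by linarith : (1 : ℝ) / 6 ≤ 1 / 2 - q w) (by norm_num)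
      (hc0.le.trans hα)]
  rw [abs_le] at hhigh hlow
  -- For either sign, the high and low nodes contribute at most `c/20` each, less than the `c/3` to
  -- be cancelled.
  rcases neg_one_pow_eq_or ℝ A with h1 | h1 <;> rw [h1] at hsum <;> linarith

/-! ### Averaged acceptance probability and the final choice of constants. -/

/-- The acceptance probability averaged over all inputs of size `k`. -/
noncomputable def Algorithm.averageAcceptProb {N m : ℕ} {W : Type*} [Fintype W] [DecidableEq W]
    (Q : Algorithm N m W) (e : PairEncoding N m) (k : ℕ) : ℝ :=
  (∑ S ∈ Finset.univ.powersetCard k, Q.acceptProb e S) / N.choose k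

section Average

variable {N m : ℕ} {W : Type*} [Fintype W] [DecidableEq W]

lemma Algorithm.averageAcceptProb_le (Q : Algorithm N m W) (e : PairEncoding N m) {k : ℕ}
    (hk : k ≤ N) {a : ℝ} (h : ∀ S : Finset (Fin N), S.card = k → Q.acceptProb e S ≤ a) :
    Q.averageAcceptProb e k ≤ a := by
  have hc : (0 : ℝ) < N.choose k := by exact_mod_cast Nat.choose_pos hk
  have hs := Finset.sum_le_card_nsmul (Finset.univ.powersetCard k) (fun S => Q.acceptProb e S) a
    fun S hS => h S (Finset.mem_powersetCard.mp hS).2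
  rw [Finset.card_powersetCard, Finset.card_univ, Fintype.card_fin, nsmul_eq_mul] at hs
  rw [Algorithm.averageAcceptProb, div_le_iff₀ hc]
  linarith

lemma Algorithm.le_averageAcceptProb (Q : Algorithm N m W) (e : PairEncoding N m) {k : ℕ}
    (hk : k ≤ N) {a : ℝ} (h : ∀ S : Finset (Fin N), S.card = k → a ≤ Q.acceptProb e S) :
    a ≤ Q.averageAcceptProb e k := by
  have hc : (0 : ℝ) < N.choose k := by exact_mod_cast Nat.choose_pos hk
  have hs := Finset.card_nsmul_le_sum (Finset.univ.powersetCard k) (fun S => Q.acceptProb e S) a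
    fun S hS => h S (Finset.mem_powersetCard.mp hS).2
  rw [Finset.card_powersetCard, Finset.card_univ, Fintype.card_fin, nsmul_eq_mul] at hs
  rw [Algorithm.averageAcceptProb, le_div_iff₀ hc]
  linarith

/-- The averaged acceptance probability is a Laurent polynomial in the size of the input. -/
lemma Algorithm.exists_polynomial_averageAcceptProb (Q : Algorithm N m W) (e : PairEncoding N m) :
    ∃ P : Polynomial ℂ, P.natDegree ≤ 2 * Q.numQueries + 8 * Q.numUsesV ∧ ∀ k ≤ N,
      P.eval (k : ℂ) = (k : ℂ) ^ (4 * Q.numUsesV) * (Q.averageAcceptProb e k : ℂ) := by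
  obtain ⟨P, hP, h⟩ := exists_polynomial_sum_powersetCard (Q.card_pow_mul_acceptProb_mem_lowDeg e)
  refine ⟨P, hP, fun k hk => ?_⟩
  have hc : (N.choose k : ℂ) ≠ 0 := by exact_mod_cast (Nat.choose_pos hk).ne'
  have hs : ∑ S ∈ Finset.univ.powersetCard k,
      ((S : Finset (Fin N)).card : ℂ) ^ (4 * Q.numUsesV) * (Q.acceptProb e S : ℂ) =
      (k : ℂ) ^ (4 * Q.numUsesV) * ∑ S ∈ Finset.univ.powersetCard k, (Q.acceptProb e S : ℂ) := by
    rw [Finset.mul_sum]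
    exact Finset.sum_congr rfl fun S hS => by rw [(Finset.mem_powersetCard.mp hS).2]
  rw [h k] at hs
  rw [Algorithm.averageAcceptProb]
  push_cast
  rw [mul_div_assoc', eq_div_iff hc, ← hs, mul_comm]

end Average

end ApxCount

theorem mainTheorem6 :
    ∃ c : ℝ, 0 < c ∧
      ∀ (N w m : ℕ), 1 ≤ w → 2 * w ≤ N →
        ∀ (e : ApxCount.PairEncoding N m) (W : Type) [Fintype W] [DecidableEq W]
          (Q : ApxCount.Algorithm N m W), Q.Decides e w →
          c * Real.sqrt ((N : ℝ) / (w : ℝ)) ≤ (Q.numQueries : ℝ) ∨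
          c * min ((w : ℝ) ^ ((1 : ℝ) / 3)) (Real.sqrt ((N : ℝ) / (w : ℝ))) ≤
            (Q.numUsesV : ℝ) := by
  refine ⟨1 / 60, by norm_num, ?_⟩
  intro N w m hw h2w e W _ _ Q hQ
  by_contra! hcon
  obtain ⟨hT, hR⟩ := hcon
  have hw' : (0 : ℝ) < w := by exact_mod_cast hw
  have hR1 : (Q.numUsesV : ℝ) ≤ 1 / 60 * (w : ℝ) ^ ((1 : ℝ) / 3) :=
    hR.le.trans (by gcongr; exact min_le_left _ _)
  have hR2 : (Q.numUsesV : ℝ) ≤ 1 / 60 * √((N : ℝ) / w) :=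
    hR.le.trans (by gcongr; exact min_le_right _ _)
  -- With `R ≤ w^(1/3) / 60` this holds because `400 * 4^3 ≤ 60^3`.
  have hB : 400 * (4 * Q.numUsesV) ^ 3 ≤ w := by
    have h1 : (Q.numUsesV : ℝ) ^ 3 ≤ (1 / 60 * (w : ℝ) ^ ((1 : ℝ) / 3)) ^ 3 := by gcongr
    have h2 : ((w : ℝ) ^ ((1 : ℝ) / 3)) ^ 3 = w := by
      rw [← Real.rpow_natCast, ← Real.rpow_mul hw'.le]
      norm_num
    rw [mul_pow, h2] at h1
    have h3 : 400 * (4 * (Q.numUsesV : ℝ)) ^ 3 ≤ w := by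
      rw [mul_pow]
      linarith
    exact_mod_cast h3
  -- This is where `1/60` is used up: `2/60 + 4/60 = 1/10`, whose square cancels the 100.
  have hA : 100 * w * (2 * Q.numQueries + 4 * Q.numUsesV) ^ 2 ≤ N := by
    have h1 : 2 * (Q.numQueries : ℝ) + 4 * Q.numUsesV ≤ 1 / 10 * √((N : ℝ) / w) := by linarith
    have h2 : (2 * (Q.numQueries : ℝ) + 4 * Q.numUsesV) ^ 2 ≤ (1 / 10 * √((N : ℝ) / w)) ^ 2 := by
      gcongr
    rw [mul_pow, Real.sq_sqrt (by positivity)] at h2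
    have h3 : 100 * (w : ℝ) * (2 * Q.numQueries + 4 * Q.numUsesV) ^ 2 ≤ N := by
      calc 100 * (w : ℝ) * (2 * Q.numQueries + 4 * Q.numUsesV) ^ 2
          ≤ 100 * w * ((1 / 10) ^ 2 * (N / w)) := by gcongr
        _ = (N : ℝ) := by
          field_simp
          norm_num
    exact_mod_cast h3
  obtain ⟨P, hP, hPq⟩ := Q.exists_polynomial_averageAcceptProb e
  refine ApxCount.not_laurent_approximation hw h2w hA hB (q := Q.averageAcceptProb e) (P := P)
    (fun k hk hkN => ⟨?_, ?_⟩) (by omega) (fun k _ hkN => hPq k hkN) ?_ ?_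
  · exact Q.le_averageAcceptProb e hkN fun S _ => Q.acceptProb_nonneg e S
  -- The upper bound 1 rests on unitarity of `V`, hence on `S` being nonempty; this is why `k ≥ 1`
  -- is required.
  · refine Q.averageAcceptProb_le e hkN fun S hS => Q.acceptProb_le_one e ?_
    exact Finset.card_pos.mp (by omega)
  · refine Q.averageAcceptProb_le e (by omega) fun S hS => ?_
    linarith [(hQ S).1 hS]
  · exact Q.le_averageAcceptProb e h2w fun S hS => (hQ S).2 hS
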